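/- A Real structure on a finite group $G$ is a group $\widehat G$ containing $G$ as a subgroup of index $2$; put $G^\sharp=\widehat G\setminus G$. A Real representation is a finite-dimensional complex vector space with an action of $\widehat G$ in which $G$ acts $\mathbb C$-linearly and $G^\sharp$ acts $\mathbb C$-antilinearly. For a complex irreducible character $\chi$ of $G$, afforded by the simple $\mathbb CG$-module $V$, let $\mathbb F_a(\chi)$ be the endomorphism algebra (one of $\mathbb R,\mathbb C,\mathbb H$) of the simple $\mathbb RG$-module that maps nontrivially to $V$, and let $\mathbb F_d(\chi)$ be the endomorphism algebra of the simple Real representation whose restriction to $G$ contains $V$. The Dyson type of $\chi$ is given by the pair $(\mathbb F_d,\mathbb F_a)$: $$\mathrm{I}=(\mathbb R,\mathbb R),\ \mathrm{II}=(\mathbb H,\mathbb R),\ \mathrm{III}=(\mathbb C,\mathbb R),\ \mathrm{V}=(\mathbb R,\mathbb C),\ \mathrm{VI}=(\mathbb H,\mathbb C),\ \mathrm{VIII}=(\mathbb H,\mathbb H),\ \mathrm{IX}=(\mathbb R,\mathbb H),\ \mathrm{X}=(\mathbb C,\mathbb H),$$ while $(\mathbb C,\mathbb C)$ is type $\mathrm{IV}$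 if $\chi$ is invariant under conjugation by elements of $G^\sharp$ and type $\mathrm{VII}$ otherwise. Let $N_?$ be the number of complex irreducible characters of $G$ of type $?$, and $\mathrm{Cl}(G)$ the set of conjugacy classes of $G$. For a word $w$ in variables $y_1,y_2,\dots$ and $z_1,z_2,\dots$ let $\Theta(w,1)$ be the number of solutions of $w=1$ with all occurring $y_i\in G$ and all occurring $z_j\in G^\sharp$. Put $$v_m=z_1^2z_2^2\cdots z_m^2\ (m\ge 3),\qquad w_n=y_1^2y_2^2z_1^2\,y_3^2y_4^2z_2^2\cdots y_{2n-1}^2y_{2n}^2z_n^2\ (n\ge 1).$$ **Theorem.** 1. Given $|G|$, the first $1+|\mathrm{Cl}(G)|$ elements of the sequence $\Theta(v_m,1)$, $m=3,4,\dots$, determine $N_{\mathrm I}+N_{\mathrm V}+N_{\mathrm{IX}}$ and $N_{\mathrm{II}}+N_{\mathrm{VI}}+N_{\mathrm{VIII}}$. That is, if $(G,\widehat G)$ and $(H,\widehat H)$ are finite groups with Real structures, $|H|=|G|$, $|\mathrm{Cl}(H)|\le|\mathrm{Cl}(G)|$, and the values $\Theta(v_m,1)$ for $3\le m\le 3+|\mathrm{Cl}(G)|$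 agree for the two, then both sums agree for the two. 2. Finitely many elements of the sequence $\Theta(w_n,1)$ determine $N_{\mathrm I}+N_{\mathrm{IX}}$ and $N_{\mathrm{II}}+N_{\mathrm{VIII}}$. That is, for every $N$ there is $K$, depending only on $N$, such that if $(G,\widehat G)$ and $(H,\widehat H)$ are finite groups with Real structures, $|G|=N$, and the values $\Theta(w_n,1)$ for $1\le n\le K$ agree for the two, then both sums agree for the two. -/

import Mathlib

open scoped Quaternion ComplexConjugate

universe u v

/-! A *Real structure* on a finite group is given by a finite group `Γ` together with a subgroup
`G` of index `2`; the group with the Real structure is `G`, and `{x : Γ // x ∉ G}` is the second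
coset. -/

section RealStructure

variable {Γ : Type*} [Group Γ] (G : Subgroup Γ)

/-- The set of complex irreducible characters of `G`. -/
def IrrChar : Set (G → ℂ) :=
  {χ | ∃ (n : ℕ) (ρ : Representation ℂ G (Fin n → ℂ)), ρ.IsIrreducible ∧ ρ.character = χ}

/-- A (finite dimensional) Real representation of `G`, on the complex vector space `ℂ ^ d`: the
group `Γ` acts by additive maps, elements of `G` act `ℂ`-linearly and elements of the second coset
act `ℂ`-antilinearly. This is the same as a module over the twisted group algebra, which is
`ℂ[Γ]` with the multiplication `α g * β h = α β g h` for `g ∈ G` and `α g * β h = α (conj β) g h`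
for `g ∉ G`. -/
structure RealRep (d : ℕ) where
  toHom : Γ →* AddMonoid.End (Fin d → ℂ)
  map_smul_of_mem : ∀ g ∈ G, ∀ (c : ℂ) (v : Fin d → ℂ), toHom g (c • v) = c • toHom g v
  map_smul_of_notMem : ∀ g ∉ G, ∀ (c : ℂ) (v : Fin d → ℂ), toHom g (c • v) = conj c • toHom g v

namespace RealRep

variable {G} {d : ℕ}

/-- A Real representation is simple if it is nonzero and has no invariant complex subspaces other
than `0` and the whole space. -/
def IsSimple (τ : RealRep G d) : Prop :=
  Nontrivial (Fin d → ℂ) ∧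
    ∀ W : Submodule ℂ (Fin d → ℂ), (∀ (g : Γ), ∀ v ∈ W, τ.toHom g v ∈ W) → W = ⊥ ∨ W = ⊤

/-- The endomorphism ring of a Real representation, as a real algebra: the complex linear maps
that commute with the action of `Γ`. -/
def endAlg (τ : RealRep G d) : Subalgebra ℝ (Module.End ℂ (Fin d → ℂ)) where
  carrier := {f | ∀ (g : Γ) (v : Fin d → ℂ), f (τ.toHom g v) = τ.toHom g (f v)}
  mul_mem' {a b} ha hb g v := by
    rw [Module.End.mul_apply, Module.End.mul_apply, hb, ha]
  add_mem' {a b} ha hb g v := by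
    rw [LinearMap.add_apply, LinearMap.add_apply, ha, hb, map_add]
  algebraMap_mem' r g v := by
    have h (u : Fin d → ℂ) :
        (algebraMap ℝ (Module.End ℂ (Fin d → ℂ)) r) u = (r : ℂ) • u := by
      ext i
      simp [Module.algebraMap_end_apply]
    rw [h, h]
    by_cases hg : g ∈ G
    · rw [τ.map_smul_of_mem g hg]
    · rw [τ.map_smul_of_notMem g hg, Complex.conj_ofReal]

end RealRep

/-- The simple `ℝG`-module that corresponds to the irreducible character `χ` has endomorphism
algebra `K`. A simple `ℝG`-module `σ` corresponds to the simple `ℂG`-module `ρ` if there is a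
nonzero `ℝG`-homomorphism `σ → ρ` (equivalently, if `ρ` is a constituent of the
complexification of `σ`). -/
def HasLinearEnd (χ : G → ℂ) (K : Type) [Ring K] [Algebra ℝ K] : Prop :=
  ∃ (n : ℕ) (ρ : Representation ℂ G (Fin n → ℂ)),
    ρ.IsIrreducible ∧ ρ.character = χ ∧
    ∃ (d : ℕ) (σ : Representation ℝ G (Fin d → ℝ)),
      σ.IsIrreducible ∧
      (∃ f : (Fin d → ℝ) →ₗ[ℝ] (Fin n → ℂ), f ≠ 0 ∧ ∀ g v, f (σ g v) = ρ g (f v)) ∧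
      Nonempty (Representation.IntertwiningMap σ σ ≃ₐ[ℝ] K)

/-- The simple Real representation that corresponds to the irreducible character `χ` has
endomorphism algebra `K`. A simple Real representation `τ` corresponds to the simple `ℂG`-module
`ρ` if there is a nonzero `ℂG`-homomorphism `ρ → τ`, that is, if `ρ` is a constituent of the
restriction of `τ` to `G`. -/
def HasRealEnd (χ : G → ℂ) (K : Type) [Ring K] [Algebra ℝ K] : Prop :=
  ∃ (n : ℕ) (ρ : Representation ℂ G (Fin n → ℂ)),
    ρ.IsIrreducible ∧ ρ.character = χ ∧
    ∃ (d : ℕ) (τ : RealRep G d),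
      τ.IsSimple ∧
      (∃ f : (Fin n → ℂ) →ₗ[ℂ] (Fin d → ℂ), f ≠ 0 ∧
        ∀ (g : G) v, f (ρ g v) = τ.toHom (g : Γ) (f v)) ∧
      Nonempty (τ.endAlg ≃ₐ[ℝ] K)

/-- The function `χ` is invariant under conjugation by the elements of the second coset. -/
def CosetInvariant (χ : G → ℂ) : Prop :=
  ∀ x : Γ, x ∉ G → ∀ g h : G, (h : Γ) = x * (g : Γ) * x⁻¹ → χ h = χ g

/-- The ten types of Dyson's tenfold way. -/
inductive DysonType
  | I | II | III | IV | V | VI | VII | VIII | IX | X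

/-- The Dyson type of `χ`. The Dyson labels of the types `I`, ..., `X` are
`RR`, `QR`, `CR`, `CC2`, `RC`, `QC`, `CC1`, `QQ`, `RQ`, `CQ`, where the first letter is the
endomorphism algebra of the corresponding simple Real representation and the second letter is the
endomorphism algebra of the corresponding simple `ℝG`-module. The type `CC2` is told from `CC1` by
the number of simple `ℂG`-modules that can be obtained from the given one by complex conjugation
and conjugation by the second coset: there are two of them for `CC2` and four for `CC1`. -/
def HasDysonType (χ : G → ℂ) : DysonType → Prop
  | .I => HasRealEnd G χ ℝ ∧ HasLinearEnd G χ ℝ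
  | .II => HasRealEnd G χ ℍ[ℝ] ∧ HasLinearEnd G χ ℝ
  | .III => HasRealEnd G χ ℂ ∧ HasLinearEnd G χ ℝ
  | .IV => HasRealEnd G χ ℂ ∧ HasLinearEnd G χ ℂ ∧ CosetInvariant G χ
  | .V => HasRealEnd G χ ℝ ∧ HasLinearEnd G χ ℂ
  | .VI => HasRealEnd G χ ℍ[ℝ] ∧ HasLinearEnd G χ ℂ
  | .VII => HasRealEnd G χ ℂ ∧ HasLinearEnd G χ ℂ ∧ ¬ CosetInvariant G χ
  | .VIII => HasRealEnd G χ ℍ[ℝ] ∧ HasLinearEnd G χ ℍ[ℝ]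
  | .IX => HasRealEnd G χ ℝ ∧ HasLinearEnd G χ ℍ[ℝ]
  | .X => HasRealEnd G χ ℂ ∧ HasLinearEnd G χ ℍ[ℝ]

/-- The number of irreducible characters of `G` of the given Dyson type. -/
noncomputable def numDyson (t : DysonType) : ℕ :=
  {χ | χ ∈ IrrChar G ∧ HasDysonType G χ t}.ncard

/-- `wordCount G w g` is the number of solutions of `w = g`, where `w` is a word in the variables
`y i = Sum.inl i`, which take values in `G`, and `z j = Sum.inr j`, which take values in the
second coset. -/
noncomputable def wordCount {α β : Type} (w : FreeGroup (α ⊕ β)) (g : Γ) : ℕ :=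
  Nat.card {p : (α → G) × (β → {x : Γ // x ∉ G}) //
    FreeGroup.lift (Sum.elim (fun i => (p.1 i : Γ)) (fun j => (p.2 j : Γ))) w = g}

end RealStructure

/-- The word `z₁² z₂² ⋯ zₘ²`. -/
def wordV (m : ℕ) : FreeGroup (Fin 0 ⊕ Fin m) :=
  (List.ofFn fun i : Fin m => FreeGroup.of (Sum.inr i) ^ 2).prod

/-- The word `y₁² y₂² z₁² y₃² y₄² z₂² ⋯ y₂ₙ₋₁² y₂ₙ² zₙ²`. -/
def wordW (n : ℕ) : FreeGroup (Fin (2 * n) ⊕ Fin n) :=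
  (List.ofFn fun i : Fin n =>
    FreeGroup.of (Sum.inl ⟨2 * i, by omega⟩) ^ 2 *
      FreeGroup.of (Sum.inl ⟨2 * i + 1, by omega⟩) ^ 2 *
      FreeGroup.of (Sum.inr i) ^ 2).prod

/-! Each irreducible character of degree d carries two signs in {0, 1, -1}: the Frobenius–Schur
indicator ν, the average of the character over the squares of G, and the Real indicator ε, its
average over the squares of the second coset. The sign ν is 1, 0, -1 according as F_a is ℝ, ℂ, ℍ,
and ε does the same for F_d. Hence the sums in part 1 count the characters with ε = 1 and ε = -1.
Those in part 2 count the characters with ν²ε = 1 and ν²ε = -1, since ν² removes the types with F_a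
= ℂ.

Both statements about signs come from one trichotomy
(`Representation.IsIrreducible.antilinear_trichotomy`): an antilinear J with Jρ(g) = ρ(θg)J either
vanishes, or can be chosen with J² = ρ(u), or with J² = -ρ(u). A twisted average of the character is
0, 1 or -1 accordingly. The choice θ = id, u = 1 gives ν; conjugation by z and u = z², with z in the
second coset, gives ε. In each case J yields an explicit module whose commutant is ℝ, ℂ or ℍ. A
division algebra has no nontrivial idempotents, so that module is simple. Simple modules attached to
the same character are isomorphic, so the cases exclude each other by dimension.

The sum of ρ over the squares of G, or of the second coset, is central, hence the scalar |G|ν/d, or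
|G|ε/d. Expanding the delta function at 1 in irreducible characters gives |G| Θ(v_m,1) = ∑ d²
(|G|ε/d)^m and |G| Θ(w_n,1) = ∑ d² ((|G|/d)³ν²ε)^n.

For part 1, ε^(j+2) = ε^j when j ≥ 1, so the values with m = j + 2 are, up to known factors, the
power sums of the numbers ε/d. There are at most |Cl(G)| of these, so Newton's identities recover
the nonzero ones with multiplicity, and their signs are counted.

For part 2 put t = ν²ε|G|/d. Then Θ(w_n,1) is the n-th moment of t³ for the weights d²/|G|, of total
mass 1. Finitely many moments determine this measure away from 0. Its largest atom is |G|, from the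
trivial character, so |G| is determined as well. A nonzero atom t has weight |G|/t² per character,
so integrating t²/|G| over t > 0 and t < 0 counts the characters. The number of moments needed is
bounded in advance because |G|⁵ ≤ Θ(w_2,1) ≤ |G|⁶. -/

/-! ### Irreducible representations -/

namespace Representation

variable {k G V W : Type*} [Field k] [Group G] [AddCommGroup V] [Module k V]
  [AddCommGroup W] [Module k W]

theorem isIrreducible_of_forall_submodule [Nontrivial V] (ρ : Representation k G V)
    (h : ∀ U : Submodule k V, (∀ g, ∀ v ∈ U, ρ g v ∈ U) → U = ⊥ ∨ U = ⊤) : ρ.IsIrreducible where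
  exists_pair_ne := by
    obtain ⟨v, hv⟩ := exists_ne (0 : V)
    refine ⟨⊥, ⊤, fun h => hv ?_⟩
    have : v ∈ (⊤ : Subrepresentation ρ).toSubmodule := Submodule.mem_top
    rw [← h] at this
    exact this
  eq_bot_or_eq_top U := by
    rcases h U.toSubmodule (fun g v hv => U.apply_mem_toSubmodule g hv) with h | h
    · exact Or.inl (Subrepresentation.toSubmodule_injective h)
    · exact Or.inr (Subrepresentation.toSubmodule_injective h)

theorem IsIrreducible.eq_bot_or_eq_top_of_forall_mem {ρ : Representation k G V}
    (h : ρ.IsIrreducible) (U : Submodule k V) (hU : ∀ g, ∀ v ∈ U, ρ g v ∈ U) :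
    U = ⊥ ∨ U = ⊤ := by
  rcases h.eq_bot_or_eq_top ⟨U, fun g v hv => hU g v hv⟩ with h | h
  · exact Or.inl (congrArg Subrepresentation.toSubmodule h)
  · exact Or.inr (congrArg Subrepresentation.toSubmodule h)

theorem IsIrreducible.nontrivial {ρ : Representation k G V} (h : ρ.IsIrreducible) :
    Nontrivial V := by
  by_contra hV
  rw [not_nontrivial_iff_subsingleton] at hV
  obtain ⟨a, b, hab⟩ := h.exists_pair_ne
  exact hab (Subrepresentation.toSubmodule_injective (Subsingleton.elim _ _))

theorem IsIrreducible.exists_eq_smul [IsAlgClosed k] [FiniteDimensional k V]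
    {ρ : Representation k G V} (h : ρ.IsIrreducible) (f : V →ₗ[k] V)
    (hf : ∀ g v, f (ρ g v) = ρ g (f v)) : ∃ c : k, ∀ v, f v = c • v := by
  obtain ⟨c, hc⟩ := (IsIrreducible.algebraMap_intertwiningMap_bijective_of_isAlgClosed
    (ρ := ρ)).2 ⟨f, fun g => LinearMap.ext fun v => hf g v⟩
  refine ⟨c, fun v => ?_⟩
  have := congrArg (fun F : IntertwiningMap ρ ρ => F v) hc
  simpa using this.symm

-- Only the kernel has to be stable under scalars; the target needs no `k`-structure. The same
-- statement therefore covers a real simple module mapping to a complex space.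
omit [Module k W] in
theorem IsIrreducible.injective_of_ne_zero {ρ : Representation k G V} (h : ρ.IsIrreducible)
    (f : V →+ W) (σ : G → W →+ W) (hf : ∀ g v, f (ρ g v) = σ g (f v))
    (hs : ∀ (c : k) v, f v = 0 → f (c • v) = 0) (h0 : f ≠ 0) :
    Function.Injective f := by
  rw [injective_iff_map_eq_zero]
  let U : Submodule k V :=
    { carrier := {v | f v = 0}
      add_mem' := fun {a b} ha hb => by
        simp only [Set.mem_ofPred_eq] at ha hb ⊢
        rw [map_add, ha, hb, add_zero]
      zero_mem' := map_zero f
      smul_mem' := fun c v hv => hs c v hv }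
  rcases h.eq_bot_or_eq_top_of_forall_mem U
    (fun g v hv => by
      change f v = 0 at hv
      change f _ = 0
      rw [hf, hv, map_zero]) with hU | hU
  · intro v hv
    have : v ∈ U := hv
    rw [hU] at this
    exact this
  · exact absurd (AddMonoidHom.ext fun v => by
      have : v ∈ U := by rw [hU]; exact Submodule.mem_top
      exact this) h0

/-- Orthogonality: the pairing of the two characters would be 0 for non-isomorphic representations,
but equals the norm 1 of a single one. -/
theorem nonempty_equiv_of_character_eq {n m : ℕ} [Finite G]
    {ρ : Representation ℂ G (Fin n → ℂ)} {σ : Representation ℂ G (Fin m → ℂ)}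
    (hρ : ρ.IsIrreducible) (hσ : σ.IsIrreducible) (h : ρ.character = σ.character) :
    Nonempty (Equiv ρ σ) := by
  classical
  have := Fintype.ofFinite G
  have hG : (Nat.card G : ℂ) ≠ 0 := by exact_mod_cast Nat.card_pos.ne'
  have := invertibleOfNonzero hG
  have h1 := char_orthonormal ρ ρ
  rw [if_pos ⟨Equiv.refl ρ⟩] at h1
  have h2 := char_orthonormal σ ρ
  rw [← h, h1] at h2
  by_contra h3
  rw [if_neg h3] at h2
  exact one_ne_zero h2

/-- The average over `G` of the conjugates of a linear map between representations. -/
noncomputable def averageHom [Fintype G] (ρ : Representation k G V) (σ : Representation k G W)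
    (f : V →ₗ[k] W) : V →ₗ[k] W :=
  (Fintype.card G : k)⁻¹ • ∑ g : G, σ g ∘ₗ f ∘ₗ ρ g⁻¹

theorem averageHom_apply [Fintype G] (ρ : Representation k G V) (σ : Representation k G W)
    (f : V →ₗ[k] W) (v : V) :
    averageHom ρ σ f v = (Fintype.card G : k)⁻¹ • ∑ g : G, σ g (f (ρ g⁻¹ v)) := by
  simp [averageHom, LinearMap.sum_apply]

theorem averageHom_comm [Fintype G] (ρ : Representation k G V) (σ : Representation k G W)
    (f : V →ₗ[k] W) (g : G) (v : V) :
    averageHom ρ σ f (ρ g v) = σ g (averageHom ρ σ f v) := by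
  rw [averageHom_apply, averageHom_apply, map_smul, map_sum]
  congr 1
  refine Fintype.sum_equiv (Equiv.mulLeft g⁻¹) _ _ fun x => ?_
  simp only [Equiv.coe_mulLeft, ← Module.End.mul_apply, ← map_mul, mul_inv_rev, inv_inv,
    mul_inv_cancel_left]

/-- Maschke: a linear left inverse stays a left inverse after averaging over the group. -/
theorem exists_equivariant_leftInverse [Finite G] [CharZero k] (ρ : Representation k G V)
    (σ : Representation k G W) (f : V →ₗ[k] W) (hf : ∀ g v, f (ρ g v) = σ g (f v))
    (hinj : Function.Injective f) :
    ∃ p : W →ₗ[k] V, (∀ g w, p (σ g w) = ρ g (p w)) ∧ ∀ v, p (f v) = v := by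
  have := Fintype.ofFinite G
  obtain ⟨q, hq⟩ := f.exists_leftInverse_of_injective (LinearMap.ker_eq_bot.2 hinj)
  have hq' (v : V) : q (f v) = v := LinearMap.congr_fun hq v
  refine ⟨averageHom σ ρ q, averageHom_comm σ ρ q, fun v => ?_⟩
  have h0 : (Fintype.card G : k) ≠ 0 := by exact_mod_cast Fintype.card_ne_zero
  rw [averageHom_apply]
  simp_rw [← hf, hq', ← Module.End.mul_apply, ← map_mul, mul_inv_cancel, map_one,
    Module.End.one_apply]
  rw [Finset.sum_const, Finset.card_univ, ← Nat.cast_smul_eq_nsmul k, smul_smul,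
    inv_mul_cancel₀ h0, one_smul]

end Representation

/-! ### Wedderburn decomposition and complete lists of irreducible characters. -/

theorem exists_linearMap_apply_eq {k V : Type*} [Field k] [AddCommGroup V] [Module k V] {v : V}
    (hv : v ≠ 0) (w : V) : ∃ f : V →ₗ[k] V, f v = w := by
  obtain ⟨f, hf⟩ := Module.Projective.exists_dual_eq_one k hv
  exact ⟨f.smulRight w, by simp [hf]⟩

/-- Left multiplication by g permutes the group basis, without fixed points unless g = 1: this is
the regular character. -/
theorem MonoidAlgebra.trace_mulLeft_of {k G : Type*} [Field k] [Group G] [Fintype G] (g : G) :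
    LinearMap.trace k (MonoidAlgebra k G) (LinearMap.mulLeft k (MonoidAlgebra.of k G g)) =
      open Classical in if g = 1 then (Fintype.card G : k) else 0 := by
  classical
  rw [LinearMap.trace_eq_matrix_trace k (MonoidAlgebra.basis G k), Matrix.trace]
  have h (x : G) : (LinearMap.toMatrix (MonoidAlgebra.basis G k) (MonoidAlgebra.basis G k)
      (LinearMap.mulLeft k (MonoidAlgebra.of k G g))).diag x = if g = 1 then 1 else 0 := by
    rw [Matrix.diag_apply, LinearMap.toMatrix_apply]
    simp [MonoidAlgebra.basis, MonoidAlgebra.single_mul_single, Finsupp.single_apply]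
  simp_rw [h]
  split_ifs <;> simp

/-- Left multiplication acts on each of the `d i` columns of the i-th factor separately. -/
theorem Matrix.trace_mulLeft_pi {k ι : Type*} [Field k] [Fintype ι] [DecidableEq ι] (d : ι → ℕ)
    (x : ∀ i, Matrix (Fin (d i)) (Fin (d i)) k) :
    LinearMap.trace k (∀ i, Matrix (Fin (d i)) (Fin (d i)) k) (LinearMap.mulLeft k x) =
      ∑ i, d i * (x i).trace := by
  rw [LinearMap.trace_eq_matrix_trace k (Pi.basis fun i => Matrix.stdBasis k (Fin (d i)) (Fin (d i))),
    Matrix.trace, Fintype.sum_sigma]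
  refine Finset.sum_congr rfl fun i _ => ?_
  have h (a b : Fin (d i)) : (LinearMap.toMatrix
      (Pi.basis fun i => Matrix.stdBasis k (Fin (d i)) (Fin (d i)))
      (Pi.basis fun i => Matrix.stdBasis k (Fin (d i)) (Fin (d i)))
      (LinearMap.mulLeft k x)).diag ⟨i, (a, b)⟩ = x i a a := by
    rw [Matrix.diag_apply, LinearMap.toMatrix_apply, Pi.basis_repr, Pi.basis_apply,
      Matrix.stdBasis_eq_single]
    simp [Matrix.stdBasis]
  rw [Fintype.sum_prod_type]
  simp_rw [h]
  simp [Matrix.trace, Finset.mul_sum]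

/-- A complete list of the irreducible complex representations of `G`. -/
structure IrreducibleList (G : Type*) [Group G] where
  card : ℕ
  deg : Fin card → ℕ
  rep : ∀ i, Representation ℂ G (Fin (deg i) → ℂ)
  isIrreducible : ∀ i, (rep i).IsIrreducible
  character_injective : Function.Injective fun i => (rep i).character
  sum_deg_mul_character : ∀ g, ∑ i, deg i * (rep i).character g =
    open Classical in if g = 1 then (Nat.card G : ℂ) else 0

/-- The projections of the group algebra onto its matrix factors are the irreducible
representations. The character identity comes from computing the trace of left multiplication by g
both in the group basis and in the matrix factors. -/
theorem nonempty_irreducibleList (G : Type*) [Group G] [Finite G] :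
    Nonempty (IrreducibleList G) := by
  classical
  have := Fintype.ofFinite G
  have : NeZero (Nat.card G : ℂ) := ⟨by exact_mod_cast Nat.card_pos.ne'⟩
  have : Module.Finite ℂ (MonoidAlgebra ℂ G) := Module.Finite.of_basis (MonoidAlgebra.basis G ℂ)
  obtain ⟨k, d, hd, ⟨e⟩⟩ :=
    IsSemisimpleRing.exists_algEquiv_pi_matrix_of_isAlgClosed ℂ (MonoidAlgebra ℂ G)
  let φ (i : Fin k) : MonoidAlgebra ℂ G →ₐ[ℂ] Module.End ℂ (Fin (d i) → ℂ) :=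
    (Matrix.toLinAlgEquiv' : Matrix (Fin (d i)) (Fin (d i)) ℂ ≃ₐ[ℂ] _).toAlgHom.comp
      ((Pi.evalAlgHom ℂ (fun i => Matrix (Fin (d i)) (Fin (d i)) ℂ) i).comp e.toAlgHom)
  have hφ (i : Fin k) (x) : φ i x = Matrix.toLinAlgEquiv' (e x i) := rfl
  let ρ (i : Fin k) : Representation ℂ G (Fin (d i) → ℂ) :=
    ((φ i : _ →* _)).comp (MonoidAlgebra.of ℂ G)
  have hρ (i : Fin k) (g) : ρ i g = φ i (MonoidAlgebra.of ℂ G g) := rfl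
  have hirr (i : Fin k) : (ρ i).IsIrreducible := by
    have := hd i
    refine Representation.isIrreducible_of_forall_submodule _ fun U hU => ?_
    have hU' (x : MonoidAlgebra ℂ G) : ∀ v ∈ U, φ i x v ∈ U := by
      induction x using MonoidAlgebra.induction_on with
      | of g => exact hU g
      | add x y hx hy =>
        intro v hv
        rw [map_add]
        exact U.add_mem (hx v hv) (hy v hv)
      | smul r x hx =>
        intro v hv
        rw [map_smul]
        exact U.smul_mem _ (hx v hv)
    by_cases h : U = ⊥
    · exact Or.inl h
    · right
      obtain ⟨v, hv, hv0⟩ := U.exists_mem_ne_zero_of_ne_bot h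
      rw [eq_top_iff]
      intro w _
      obtain ⟨f, hf⟩ := exists_linearMap_apply_eq (k := ℂ) hv0 w
      -- The i-th factor contains every endomorphism, in particular one that sends v to w.
      have := hU' (e.symm (Pi.single i (Matrix.toLinAlgEquiv'.symm f))) v hv
      rw [hφ, AlgEquiv.apply_symm_apply, Pi.single_eq_same, AlgEquiv.apply_symm_apply, hf] at this
      exact this
  refine ⟨⟨k, d, ρ, hirr, fun i j hij => ?_, fun g => ?_⟩⟩
  · obtain ⟨f⟩ := Representation.nonempty_equiv_of_character_eq (hirr i) (hirr j) hij
    have hf (x : MonoidAlgebra ℂ G) : ∀ v, f (φ i x v) = φ j x (f v) := by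
      induction x using MonoidAlgebra.induction_on with
      | of g => exact fun v => Representation.IntertwiningMap.isIntertwining _ _ f.toIntertwiningMap g v
      | add x y hx hy =>
        intro v
        simp only [map_add, LinearMap.add_apply, hx, hy]
      | smul r x hx =>
        intro v
        simp only [map_smul, LinearMap.smul_apply, hx]
    by_contra hne
    have := hd i
    obtain ⟨v, hv⟩ := exists_ne (0 : Fin (d i) → ℂ)
    -- The unit of the i-th factor acts as 1 on the i-th representation and as 0 on the j-th.
    have h := hf (e.symm (Pi.single i 1)) v
    rw [hφ, hφ, AlgEquiv.apply_symm_apply, Pi.single_eq_same, Pi.single_eq_of_ne (Ne.symm hne),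
      map_one, map_zero, Module.End.one_apply, LinearMap.zero_apply] at h
    exact hv (by simpa using h)
  · have h := MonoidAlgebra.trace_mulLeft_of (k := ℂ) g
    rw [← LinearMap.trace_conj' _ e.toLinearEquiv] at h
    have h2 : e.toLinearEquiv.conj (LinearMap.mulLeft ℂ (MonoidAlgebra.of ℂ G g)) =
        LinearMap.mulLeft ℂ (e (MonoidAlgebra.of ℂ G g)) := by
      refine LinearMap.ext fun x => ?_
      simp [LinearEquiv.conj_apply]
    rw [h2, Matrix.trace_mulLeft_pi] at h
    rw [Nat.card_eq_fintype_card]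
    convert! h using 3 with i
    exact (Matrix.trace_toLin'_eq _)

namespace IrreducibleList

variable {G : Type*} [Group G] [Finite G] (L : IrreducibleList G)

omit [Finite G] in
theorem deg_pos (i : Fin L.card) : 0 < L.deg i := by
  by_contra h
  have := (L.isIrreducible i).nontrivial
  have : IsEmpty (Fin (L.deg i)) := by
    rw [Nat.eq_zero_of_not_pos h]
    infer_instance
  exact not_subsingleton (Fin (L.deg i) → ℂ) inferInstance

/-- A character orthogonal to the whole list is orthogonal to the regular character; but that
pairing is |G| times its degree. -/
theorem exists_character_eq {n : ℕ} {ρ : Representation ℂ G (Fin n → ℂ)} (hρ : ρ.IsIrreducible) :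
    ∃ i, (L.rep i).character = ρ.character := by
  classical
  have := Fintype.ofFinite G
  have hG : (Nat.card G : ℂ) ≠ 0 := by exact_mod_cast Nat.card_pos.ne'
  have := invertibleOfNonzero hG
  by_contra! h
  have h1 (i) : ∑ g, (L.rep i).character g * ρ.character g⁻¹ = 0 := by
    have := L.isIrreducible i
    have := Representation.char_orthonormal (L.rep i) ρ
    rw [if_neg] at this
    · exact (mul_eq_zero.1 this).resolve_left (inv_ne_zero hG)
    · rintro ⟨f⟩
      exact h i (Representation.char_iso f).symm
  have h2 : ∑ g, (∑ i, L.deg i * (L.rep i).character g) * ρ.character g⁻¹ = 0 := by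
    simp_rw [Finset.sum_mul]
    rw [Finset.sum_comm]
    simp_rw [mul_assoc, ← Finset.mul_sum, h1, mul_zero, Finset.sum_const_zero]
  simp_rw [L.sum_deg_mul_character] at h2
  simp only [ite_mul, zero_mul, Finset.sum_ite_eq', Finset.mem_univ, if_true, inv_one,
    Representation.char_one, Module.finrank_fin_fun, mul_eq_zero, hG, false_or] at h2
  have hn : n = 0 := by exact_mod_cast h2
  subst hn
  have := hρ.nontrivial
  exact not_subsingleton (Fin 0 → ℂ) inferInstance

/-- By orthogonality the listed characters are linearly independent class functions. -/
theorem card_le : L.card ≤ Nat.card (ConjClasses G) := by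
  classical
  have := Fintype.ofFinite G
  have : Fintype (ConjClasses G) := Fintype.ofFinite _
  have hG : (Nat.card G : ℂ) ≠ 0 := by exact_mod_cast Nat.card_pos.ne'
  have := invertibleOfNonzero hG
  let f (i : Fin L.card) : ConjClasses G → ℂ := Quotient.lift (L.rep i).character (by
    rintro a b ⟨c, hc⟩
    rw [SemiconjBy, ← mul_inv_eq_iff_eq_mul] at hc
    rw [← hc, Representation.char_conj])
  have hf (i g) : f i (ConjClasses.mk g) = (L.rep i).character g := rfl
  have hli : LinearIndependent ℂ f := by
    rw [Fintype.linearIndependent_iff]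
    intro a ha j
    have h1 (i) : (Nat.card G : ℂ)⁻¹ * ∑ g, (L.rep i).character g * (L.rep j).character g⁻¹ =
        if i = j then 1 else 0 := by
      have := L.isIrreducible i
      have := L.isIrreducible j
      rw [Representation.char_orthonormal]
      congr 1
      refine propext ⟨?_, ?_⟩
      · rintro ⟨f⟩
        exact L.character_injective (Representation.char_iso f).symm
      · rintro rfl
        exact ⟨Representation.Equiv.refl _⟩
    have h2 (g : G) : ∑ i, a i * (L.rep i).character g = 0 := by
      have := congrFun ha (ConjClasses.mk g)
      simpa [hf] using this
    have h3 : ∑ i, a i * ((Nat.card G : ℂ)⁻¹ *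
        ∑ g, (L.rep i).character g * (L.rep j).character g⁻¹) = 0 := by
      have : (Nat.card G : ℂ)⁻¹ *
          ∑ g, (∑ i, a i * (L.rep i).character g) * (L.rep j).character g⁻¹ = 0 := by simp [h2]
      rw [← this]
      simp_rw [Finset.mul_sum, Finset.sum_mul, Finset.mul_sum]
      rw [Finset.sum_comm]
      exact Finset.sum_congr rfl fun _ _ => Finset.sum_congr rfl fun _ _ => by ring
    simp_rw [h1] at h3
    simpa using h3
  have := hli.fintype_card_le_finrank
  simpa [Nat.card_eq_fintype_card] using this

omit [Finite G] in
theorem sum_deg_sq : ∑ i, L.deg i ^ 2 = Nat.card G := by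
  have h := L.sum_deg_mul_character 1
  simp only [Representation.char_one, Module.finrank_fin_fun, if_true] at h
  simp_rw [sq]
  exact_mod_cast h

end IrreducibleList

/-! ### Antilinear intertwiners and twisted Frobenius–Schur indicators -/

section UnitaryMatrix

open Matrix

variable {G : Type*} [Group G] {n : ℕ} {R : G →* Matrix (Fin n) (Fin n) ℂ}

theorem Matrix.entrywiseConj_mul (A B : Matrix (Fin n) (Fin n) ℂ) : (A * B)ᴴᵀ = Aᴴᵀ * Bᴴᵀ := by
  rw [conjTranspose_mul, transpose_mul]

theorem Matrix.entrywiseConj_entrywiseConj (A : Matrix (Fin n) (Fin n) ℂ) : Aᴴᵀᴴᵀ = A :=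
  Matrix.ext fun i j => by simp

theorem conjTranspose_eq_inv (hU : ∀ g, R g * (R g)ᴴ = 1) (g : G) : (R g)ᴴ = R g⁻¹ :=
  (left_inv_eq_right_inv (by rw [← map_mul, inv_mul_cancel, map_one]) (hU g)).symm

theorem conj_eq_transpose_inv (hU : ∀ g, R g * (R g)ᴴ = 1) (g : G) : (R g)ᴴᵀ = (R g⁻¹)ᵀ := by
  rw [conjTranspose_eq_inv hU]

theorem intertwiner_conjTranspose (hU : ∀ g, R g * (R g)ᴴ = 1) {θ : G →* G}
    {B : Matrix (Fin n) (Fin n) ℂ} (hB : ∀ g, B * (R g)ᴴᵀ = R (θ g) * B) (g : G) :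
    Bᴴ * R (θ g) = (R g)ᴴᵀ * Bᴴ := by
  have h1 := congrArg conjTranspose (hB g⁻¹)
  rw [conjTranspose_mul, conjTranspose_mul, conjTranspose_eq_inv hU (θ _), ← map_inv, inv_inv,
    ← conjTranspose_eq_inv hU g, conjTranspose_conjTranspose] at h1
  exact h1.symm

/-- The equivariant matrix obtained from `X` by averaging. -/
def twistedAverage [Fintype G] (R : G →* Matrix (Fin n) (Fin n) ℂ) (θ : G →* G)
    (X : Matrix (Fin n) (Fin n) ℂ) : Matrix (Fin n) (Fin n) ℂ :=
  ∑ g, R (θ g) * X * (R g)ᵀ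

/-- For unitary R the entrywise conjugate of R(g) is the transpose of R(g⁻¹), so multiplying on the
right by it is a translation of the summation variable. A matrix B with this property encodes the
antilinear map that sends v to B times the conjugate of v. -/
theorem twistedAverage_intertwiner [Fintype G] (hU : ∀ g, R g * (R g)ᴴ = 1) (θ : G →* G)
    (X : Matrix (Fin n) (Fin n) ℂ) (g : G) :
    twistedAverage R θ X * (R g)ᴴᵀ = R (θ g) * twistedAverage R θ X := by
  rw [twistedAverage, Finset.sum_mul, Finset.mul_sum, conj_eq_transpose_inv hU]
  refine (Fintype.sum_equiv (Equiv.mulLeft g) _ _ fun x => ?_).symm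
  simp only [Equiv.coe_mulLeft, map_mul, transpose_mul, Matrix.mul_assoc]
  rw [← transpose_mul, ← transpose_mul, ← map_mul, inv_mul_cancel, map_one, Matrix.one_mul]

/-- The product R(g)_{lk} R(θg)_{ki} is the (k, l) entry of R(θg) E_{ik} R(g)ᵀ, so the trace sum is
assembled from averages of matrix units, to which Schur's lemma applies. -/
theorem sum_trace_twisted [Fintype G] (θ : G →* G) (U : Matrix (Fin n) (Fin n) ℂ) :
    ∑ g, (R g * R (θ g) * U).trace =
      ∑ i, ∑ k, ∑ l, twistedAverage R θ (single i k 1) k l * U i l := by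
  have h (i k l) : twistedAverage R θ (single i k 1) k l = ∑ g, R g l k * R (θ g) k i := by
    rw [twistedAverage, Matrix.sum_apply]
    refine Finset.sum_congr rfl fun g _ => ?_
    rw [Matrix.mul_apply, Finset.sum_eq_single k]
    · rw [Matrix.mul_apply, Finset.sum_eq_single i]
      · simp [mul_comm]
      · intro b _ hb
        simp [Ne.symm hb]
      · simp
    · intro b _ hb
      rw [Matrix.mul_apply, Finset.sum_eq_zero]
      · simp
      · intro c _
        simp [Ne.symm hb]
    · simp
  simp_rw [h, Finset.sum_mul, Matrix.trace, Matrix.diag_apply, Matrix.mul_apply, Finset.sum_mul]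
  rw [Finset.sum_comm]
  have e1 : ∀ l, ∑ g, ∑ i, ∑ k, R g l k * R (θ g) k i * U i l =
      ∑ i, ∑ k, ∑ g, R g l k * R (θ g) k i * U i l := fun l => by
    rw [Finset.sum_comm]
    exact Finset.sum_congr rfl fun i _ => Finset.sum_comm
  simp_rw [e1]
  rw [Finset.sum_comm]
  exact Finset.sum_congr rfl fun i _ => Finset.sum_comm

theorem sum_trace_twisted_eq_zero [Fintype G] (hU : ∀ g, R g * (R g)ᴴ = 1) (θ : G →* G)
    (U : Matrix (Fin n) (Fin n) ℂ)
    (h : ∀ B : Matrix (Fin n) (Fin n) ℂ, (∀ g, B * (R g)ᴴᵀ = R (θ g) * B) → B = 0) :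
    ∑ g, (R g * R (θ g) * U).trace = 0 := by
  rw [sum_trace_twisted]
  simp [h _ (twistedAverage_intertwiner hU θ _)]

/-- By Schur's lemma every twisted average is a multiple of B, and the trace against Bᴴ gives the
factor. The sum then reduces to the trace of Bᴴ U Bᵀ, which is εn because U = ε B Bᴴᵀ and B is
unitary. -/
theorem sum_trace_twisted_of_intertwiner [Fintype G] [NeZero n] (hU : ∀ g, R g * (R g)ᴴ = 1)
    (hS : ∀ M, (∀ g, M * R g = R g * M) → ∃ c : ℂ, M = c • (1 : Matrix (Fin n) (Fin n) ℂ))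
    {θ : G →* G} {U B : Matrix (Fin n) (Fin n) ℂ} (hB : ∀ g, B * (R g)ᴴᵀ = R (θ g) * B)
    (hBB : B * Bᴴ = 1) (ε : ℂ) (hε : B * Bᴴᵀ = ε • U) (hε2 : ε * ε = 1) :
    ∑ g, (R g * R (θ g) * U).trace = ε * Fintype.card G := by
  have hBB' : Bᴴ * B = 1 := mul_eq_one_comm.1 hBB
  have hn : (n : ℂ) ≠ 0 := NeZero.ne _
  have h1 (X) : (n : ℂ) • twistedAverage R θ X = (Fintype.card G * (Bᴴ * X).trace) • B := by
    -- The product of Bᴴ and the average commutes with the conjugate representation, while `hS`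
    -- concerns R itself; hence the entrywise conjugate.
    obtain ⟨c, hc⟩ := hS (Bᴴ * twistedAverage R θ X)ᴴᵀ fun g => by
      have : Bᴴ * twistedAverage R θ X * (R g)ᴴᵀ = (R g)ᴴᵀ * (Bᴴ * twistedAverage R θ X) := by
        rw [Matrix.mul_assoc, twistedAverage_intertwiner hU, ← Matrix.mul_assoc,
          intertwiner_conjTranspose hU hB, Matrix.mul_assoc]
      have h2 := congrArg (fun M => Mᴴᵀ) this
      simp only [entrywiseConj_mul, entrywiseConj_entrywiseConj] at h2
      rw [entrywiseConj_mul, h2]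
    have hc' : Bᴴ * twistedAverage R θ X = star c • (1 : Matrix (Fin n) (Fin n) ℂ) := by
      have h2 := congrArg (fun M => Mᴴᵀ) hc
      simp only [entrywiseConj_entrywiseConj] at h2
      rw [h2, conjTranspose_smul, conjTranspose_one, transpose_smul, transpose_one]
    have hT : twistedAverage R θ X = star c • B := by
      have := congrArg (B * ·) hc'
      simpa only [← Matrix.mul_assoc, hBB, Matrix.one_mul, Matrix.mul_smul, Matrix.mul_one] using this
    have htr : (Bᴴ * twistedAverage R θ X).trace = Fintype.card G * (Bᴴ * X).trace := by
      rw [twistedAverage, Finset.mul_sum, Matrix.trace_sum]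
      have h3 (g : G) : (Bᴴ * (R (θ g) * X * (R g)ᵀ)).trace = (Bᴴ * X).trace := by
        rw [← Matrix.mul_assoc, ← Matrix.mul_assoc, intertwiner_conjTranspose hU hB,
          Matrix.trace_mul_comm, ← Matrix.mul_assoc, ← Matrix.mul_assoc, ← transpose_mul]
        have : (R g)ᴴ * R g = 1 := mul_eq_one_comm.1 (hU g)
        rw [this, transpose_one, Matrix.one_mul]
      simp [h3]
    rw [hc', Matrix.trace_smul, Matrix.trace_one, Fintype.card_fin, smul_eq_mul] at htr
    rw [← htr, hT, smul_smul, mul_comm]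
  have h2 : (n : ℂ) * ∑ g, (R g * R (θ g) * U).trace = n * (ε * Fintype.card G) := by
    have h3 : ∀ i k l, (n : ℂ) * (twistedAverage R θ (single i k 1) k l * U i l) =
        Fintype.card G * (star (B i k) * B k l * U i l) := by
      intro i k l
      have := congrFun (congrFun (h1 (single i k 1)) k) l
      rw [Matrix.smul_apply, Matrix.smul_apply, smul_eq_mul, smul_eq_mul, trace_mul_single] at this
      rw [← mul_assoc, this]
      simp [mul_assoc]
    have h4 : ∑ i, ∑ k, ∑ l, star (B i k) * B k l * U i l = (Bᴴ * (U * Bᵀ)).trace := by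
      rw [Finset.sum_comm]
      simp only [Matrix.trace, Matrix.diag_apply, Matrix.mul_apply, Finset.mul_sum,
        conjTranspose_apply, transpose_apply]
      refine Finset.sum_congr rfl fun _ _ => Finset.sum_congr rfl fun _ _ =>
        Finset.sum_congr rfl fun _ _ => by ring
    have h5 : U = ε • (B * Bᴴᵀ) := by rw [hε, smul_smul, hε2, one_smul]
    have h6 : Bᴴᵀ * Bᵀ = 1 := by rw [← transpose_mul, hBB, transpose_one]
    rw [sum_trace_twisted]
    simp_rw [Finset.mul_sum, h3, ← Finset.mul_sum]
    rw [h4, h5, Matrix.smul_mul, Matrix.mul_assoc, h6, Matrix.mul_one, Matrix.mul_smul, hBB',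
      Matrix.trace_smul, Matrix.trace_one, Fintype.card_fin, smul_eq_mul]
    ring
  exact mul_left_cancel₀ hn h2

end UnitaryMatrix

/-! ### Unitary coordinates and normalization of the antilinear intertwiner. -/

section UnitaryMatrix

open Matrix

variable {G : Type*} [Group G] {n : ℕ}

-- The sum of the R(g)ᴴR(g) is an invariant positive definite form; writing it as QᴴQ, conjugation
-- by Q makes it the standard form.
open scoped MatrixOrder ComplexOrder in
theorem exists_unitary_conj [Finite G] (R : G →* Matrix (Fin n) (Fin n) ℂ) :
    ∃ Q Q' : Matrix (Fin n) (Fin n) ℂ, Q * Q' = 1 ∧ Q' * Q = 1 ∧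
      ∀ g, (Q * R g * Q') * (Q * R g * Q')ᴴ = 1 := by
  have := Fintype.ofFinite G
  have hinv (g : G) : R g⁻¹ * R g = 1 := by rw [← map_mul, inv_mul_cancel, map_one]
  have hP : (∑ g, (R g)ᴴ * R g).PosDef := by
    refine posDef_sum ⟨1, Finset.mem_univ _⟩ fun g _ => PosDef.conjTranspose_mul_self _ ?_
    intro v w h
    have := congrArg (R g⁻¹ *ᵥ ·) h
    simpa [hinv] using this
  obtain ⟨Q, hQ⟩ := CStarAlgebra.nonneg_iff_eq_star_mul_self.mp hP.posSemidef.nonneg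
  obtain ⟨S, hS⟩ := hP.isUnit.exists_left_inv
  rw [hQ, ← Matrix.mul_assoc] at hS
  have hS' : Q * (S * star Q) = 1 := mul_eq_one_comm.1 hS
  refine ⟨Q, S * star Q, hS', hS, fun g => mul_eq_one_comm.1 ?_⟩
  have h1 : (R g)ᴴ * (star Q * Q) * R g = star Q * Q := by
    rw [← hQ, Finset.mul_sum, Finset.sum_mul]
    refine Fintype.sum_equiv (Equiv.mulRight g) _ _ fun x => ?_
    simp only [Equiv.coe_mulRight, map_mul, conjTranspose_mul, Matrix.mul_assoc]
  have h2 : (S * star Q)ᴴ * star Q = 1 := by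
    rw [← star_eq_conjTranspose, ← star_mul, hS', star_one]
  calc (Q * R g * (S * star Q))ᴴ * (Q * R g * (S * star Q))
      = (S * star Q)ᴴ * ((R g)ᴴ * (star Q * Q) * R g) * (S * star Q) := by
        simp only [conjTranspose_mul, star_eq_conjTranspose, Matrix.mul_assoc]
    _ = ((S * star Q)ᴴ * star Q) * (Q * (S * star Q)) := by
        rw [h1]
        simp only [Matrix.mul_assoc]
    _ = 1 := by rw [h2, hS', Matrix.one_mul]

-- Schur's lemma gives B Bᴴ = r with r > 0 and B Bᴴᵀ = l R(u). Evaluating B Bᴴᵀ B in two ways, with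
-- θu = u, shows that l is real; comparing norms gives l² = r². Dividing B by √r leaves the sign
-- l/r.
open scoped ComplexOrder in
theorem exists_normalized_intertwiner {R : G →* Matrix (Fin n) (Fin n) ℂ}
    (hU : ∀ g, R g * (R g)ᴴ = 1)
    (hS : ∀ M, (∀ g, M * R g = R g * M) → ∃ c : ℂ, M = c • (1 : Matrix (Fin n) (Fin n) ℂ))
    {θ : G →* G} {u : G} (hθu : θ u = u) (hθ : ∀ g, θ (θ g) = u * g * u⁻¹)
    {B : Matrix (Fin n) (Fin n) ℂ} (hB : ∀ g, B * (R g)ᴴᵀ = R (θ g) * B) (hB0 : B ≠ 0) :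
    ∃ (B' : Matrix (Fin n) (Fin n) ℂ) (ε : ℂ), (∀ g, B' * (R g)ᴴᵀ = R (θ g) * B') ∧
      B' * B'ᴴ = 1 ∧ B' * B'ᴴᵀ = ε • R u ∧ (ε = 1 ∨ ε = -1) := by
  have hne : Nonempty (Fin n) := by
    by_contra h
    rw [not_nonempty_iff] at h
    exact hB0 (Subsingleton.elim _ _)
  obtain ⟨i₀⟩ := hne
  have hinv (g : G) : R g⁻¹ * R g = 1 := by rw [← map_mul, inv_mul_cancel, map_one]
  have hinv' (g : G) : R g * R g⁻¹ = 1 := by rw [← map_mul, mul_inv_cancel, map_one]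
  -- The square of θ is inner, so θ is onto. This is needed because B Bᴴ is only seen to commute
  -- with the matrices R(θ h).
  have hsurj (g : G) : ∃ h, θ h = g := ⟨θ (u⁻¹ * g * u), by rw [hθ]; group⟩
  obtain ⟨c, hc⟩ := hS (B * Bᴴ) fun g => by
    obtain ⟨h, rfl⟩ := hsurj g
    rw [Matrix.mul_assoc, intertwiner_conjTranspose hU hB, ← Matrix.mul_assoc, hB, Matrix.mul_assoc]
  obtain ⟨r, hr, hrc⟩ : ∃ r : ℝ, 0 < r ∧ c = r := by
    have h0 : 0 ≤ c := by
      have := (posSemidef_self_mul_conjTranspose B).diag_nonneg (i := i₀)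
      rw [hc] at this
      simpa using this
    have hc0 : c ≠ 0 := by
      rintro rfl
      rw [zero_smul] at hc
      exact hB0 (self_mul_conjTranspose_eq_zero.1 hc)
    have h1 := lt_of_le_of_ne h0 hc0.symm
    rw [Complex.lt_def] at h1
    exact ⟨c.re, h1.1, Complex.ext rfl h1.2.symm⟩
  obtain ⟨l, hl⟩ := hS (R u⁻¹ * (B * Bᴴᵀ)) fun g => by
    have h1 := congrArg (fun M => Mᴴᵀ) (hB g)
    simp only [entrywiseConj_mul, entrywiseConj_entrywiseConj] at h1
    rw [Matrix.mul_assoc, Matrix.mul_assoc, h1, ← Matrix.mul_assoc B, hB, hθ, map_mul, map_mul,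
      ← Matrix.mul_assoc, ← Matrix.mul_assoc, ← Matrix.mul_assoc, ← Matrix.mul_assoc, hinv,
      Matrix.one_mul]
    simp only [Matrix.mul_assoc]
  have hl' : B * Bᴴᵀ = l • R u := by
    have := congrArg (R u * ·) hl
    simpa only [← Matrix.mul_assoc, hinv', Matrix.one_mul, Matrix.mul_smul, Matrix.mul_one] using this
  have hreal : star l = l := by
    have h1 := congrArg (fun M => Mᴴᵀ) hl'
    simp only [entrywiseConj_mul, entrywiseConj_entrywiseConj, conjTranspose_smul, transpose_smul] at h1
    have h2 : l • (R u * B) = star l • (R u * B) := by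
      rw [← Matrix.smul_mul, ← hl', Matrix.mul_assoc, h1, Matrix.mul_smul, hB, hθu]
    by_contra h3
    have h4 : (star l - l) • (R u * B) = 0 := by rw [sub_smul, ← h2, sub_self]
    have h5 := (smul_eq_zero.1 h4).resolve_left (sub_ne_zero.2 h3)
    apply hB0
    rw [← Matrix.one_mul B, ← hinv u, Matrix.mul_assoc, h5, Matrix.mul_zero]
  have hsq : l * l = r * r := by
    have h1 : (B * Bᴴᵀ) * (B * Bᴴᵀ)ᴴ = (r * r : ℂ) • (1 : Matrix (Fin n) (Fin n) ℂ) := by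
      have h3 : Bᴴᵀ * Bᴴᵀᴴ = (r : ℂ) • (1 : Matrix (Fin n) (Fin n) ℂ) := by
        have h4 := congrArg (fun M => Mᴴᵀ) hc
        simp only [entrywiseConj_mul, conjTranspose_smul, transpose_smul, conjTranspose_one,
          transpose_one] at h4
        rw [hrc] at h4
        have h5 : Bᴴᵀᴴ = Bᴴᴴᵀ := Matrix.ext fun i j => by simp
        rw [h5, h4]
        simp
      rw [conjTranspose_mul, Matrix.mul_assoc, ← Matrix.mul_assoc Bᴴᵀ, h3, Matrix.smul_mul,
        Matrix.one_mul, Matrix.mul_smul, hc, smul_smul, hrc]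
    rw [hl', conjTranspose_smul, Matrix.smul_mul, Matrix.mul_smul, hU, smul_smul, hreal] at h1
    have := congrFun (congrFun h1 i₀) i₀
    simpa using this
  have hr0 : (r : ℂ) ≠ 0 := by exact_mod_cast hr.ne'
  have hs : (((√r)⁻¹ : ℝ) : ℂ) * ((√r)⁻¹ : ℝ) = (r : ℂ)⁻¹ := by
    rw [Complex.ofReal_inv, ← mul_inv]
    congr 1
    exact_mod_cast Real.mul_self_sqrt hr.le
  have hstar : star (((√r)⁻¹ : ℝ) : ℂ) = ((√r)⁻¹ : ℝ) := by simp
  refine ⟨(((√r)⁻¹ : ℝ) : ℂ) • B, l / r, fun g => ?_, ?_, ?_, ?_⟩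
  · rw [Matrix.smul_mul, hB, Matrix.mul_smul]
  · rw [conjTranspose_smul, Matrix.smul_mul, Matrix.mul_smul, smul_smul, hc, hstar, hs, smul_smul,
      hrc, inv_mul_cancel₀ hr0, one_smul]
  · rw [conjTranspose_smul, transpose_smul, Matrix.smul_mul, Matrix.mul_smul, smul_smul, hstar, hs,
      hl', smul_smul, div_eq_inv_mul]
  · rw [div_eq_iff hr0, div_eq_iff hr0, one_mul, neg_one_mul]
    exact mul_self_eq_mul_self_iff.1 hsq

/-- The twisted Frobenius–Schur trichotomy. -/
theorem Representation.IsIrreducible.antilinear_trichotomy [Fintype G]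
    {ρ : Representation ℂ G (Fin n → ℂ)} (hρ : ρ.IsIrreducible) (θ : G →* G) (u : G)
    (hθu : θ u = u) (hθ : ∀ g, θ (θ g) = u * g * u⁻¹) :
    (∑ g, ρ.character (g * θ g * u) = 0 ∧
      ∀ J : (Fin n → ℂ) →ₛₗ[starRingEnd ℂ] (Fin n → ℂ),
        (∀ g v, J (ρ g v) = ρ (θ g) (J v)) → J = 0) ∨
    (∑ g, ρ.character (g * θ g * u) = Fintype.card G ∧
      ∃ J : (Fin n → ℂ) →ₛₗ[starRingEnd ℂ] (Fin n → ℂ),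
        (∀ g v, J (ρ g v) = ρ (θ g) (J v)) ∧ ∀ v, J (J v) = ρ u v) ∨
    (∑ g, ρ.character (g * θ g * u) = -Fintype.card G ∧
      ∃ J : (Fin n → ℂ) →ₛₗ[starRingEnd ℂ] (Fin n → ℂ),
        (∀ g v, J (ρ g v) = ρ (θ g) (J v)) ∧ ∀ v, J (J v) = -ρ u v) := by
  have hn : NeZero n := ⟨by
    rintro rfl
    have := hρ.nontrivial
    exact not_subsingleton (Fin 0 → ℂ) inferInstance⟩
  let R₀ : G →* Matrix (Fin n) (Fin n) ℂ :=
    ((LinearMap.toMatrixAlgEquiv' : _ ≃ₐ[ℂ] Matrix (Fin n) (Fin n) ℂ) : _ →* _).comp ρ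
  have hR₀ (g v) : R₀ g *ᵥ v = ρ g v := LinearMap.toMatrix'_mulVec (ρ g) v
  obtain ⟨Q, Q', hQ, hQ', hU⟩ := exists_unitary_conj R₀
  let R : G →* Matrix (Fin n) (Fin n) ℂ :=
    { toFun := fun g => Q * R₀ g * Q'
      map_one' := by rw [map_one, Matrix.mul_one, hQ]
      map_mul' := fun g h => by
        rw [map_mul]
        calc Q * (R₀ g * R₀ h) * Q' = Q * R₀ g * 1 * R₀ h * Q' := by
              simp only [Matrix.mul_assoc, Matrix.one_mul]
          _ = _ := by
              rw [← hQ']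
              simp only [Matrix.mul_assoc] }
  have hR (g) : R g = Q * R₀ g * Q' := rfl
  have hRv (g v) : R g *ᵥ v = Q *ᵥ ρ g (Q' *ᵥ v) := by
    rw [hR, ← mulVec_mulVec, ← mulVec_mulVec, hR₀]
  have hU' : ∀ g, R g * (R g)ᴴ = 1 := hU
  have hS (M) (hM : ∀ g, M * R g = R g * M) :
      ∃ c : ℂ, M = c • (1 : Matrix (Fin n) (Fin n) ℂ) := by
    obtain ⟨c, hc⟩ := hρ.exists_eq_smul (Matrix.mulVecLin (Q' * M * Q)) fun g v => by
      have h1 := congrArg (· *ᵥ (Q *ᵥ v)) (hM g)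
      simp only [← mulVec_mulVec, hRv] at h1
      simp only [mulVecLin_apply, ← mulVec_mulVec]
      rw [mulVec_mulVec v Q' Q, hQ', one_mulVec] at h1
      rw [h1, mulVec_mulVec _ Q' Q, hQ', one_mulVec]
    refine ⟨c, ext_of_mulVec_single fun i => ?_⟩
    have h1 := congrArg (Q *ᵥ ·) (hc (Q' *ᵥ Pi.single i 1))
    simp only [mulVecLin_apply, mulVec_smul, mulVec_mulVec, Matrix.mul_assoc] at h1
    rw [hQ, Matrix.mul_one, ← Matrix.mul_assoc, hQ, Matrix.one_mul] at h1
    rw [h1, smul_mulVec]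
  have hchar : ∑ g, ρ.character (g * θ g * u) = ∑ g, (R g * R (θ g) * R u).trace := by
    refine Finset.sum_congr rfl fun g _ => ?_
    rw [← map_mul, ← map_mul, hR, Matrix.mul_assoc, Matrix.trace_mul_comm, Matrix.mul_assoc, hQ',
      Matrix.mul_one]
    exact (LinearMap.trace_eq_matrix_trace ℂ (Pi.basisFun ℂ (Fin n)) _).trans rfl
  have hstarv (A : Matrix (Fin n) (Fin n) ℂ) (v) : star (A *ᵥ v) = Aᴴᵀ *ᵥ star v := by
    rw [star_mulVec, ← mulVec_transpose]
  have hJ (B : Matrix (Fin n) (Fin n) ℂ) (hB : ∀ g, B * (R g)ᴴᵀ = R (θ g) * B) :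
      ∃ J : (Fin n → ℂ) →ₛₗ[starRingEnd ℂ] (Fin n → ℂ),
        (∀ g v, J (ρ g v) = ρ (θ g) (J v)) ∧
          ∀ v, J (J v) = Q' *ᵥ ((B * Bᴴᵀ) *ᵥ (Q *ᵥ v)) := by
    refine ⟨{ toFun := fun v => Q' *ᵥ (B *ᵥ star (Q *ᵥ v))
              map_add' := fun v w => by rw [mulVec_add, star_add, mulVec_add, mulVec_add]
              map_smul' := fun c v => by
                rw [mulVec_smul, star_smul, mulVec_smul, mulVec_smul]
                rfl }, fun g v => ?_, fun v => ?_⟩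
    · change Q' *ᵥ (B *ᵥ star (Q *ᵥ ρ g v)) = ρ (θ g) (Q' *ᵥ (B *ᵥ star (Q *ᵥ v)))
      have h1 : Q *ᵥ ρ g v = R g *ᵥ (Q *ᵥ v) := by
        rw [hRv, mulVec_mulVec v Q' Q, hQ', one_mulVec]
      rw [h1, hstarv (R g), mulVec_mulVec _ B, hB, ← mulVec_mulVec, hRv, mulVec_mulVec _ Q' Q, hQ',
        one_mulVec]
    · change Q' *ᵥ (B *ᵥ star (Q *ᵥ (Q' *ᵥ (B *ᵥ star (Q *ᵥ v))))) = _
      rw [mulVec_mulVec _ Q Q', hQ, one_mulVec, hstarv B, star_star, ← mulVec_mulVec]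
  have hQu (v) : Q' *ᵥ (R u *ᵥ (Q *ᵥ v)) = ρ u v := by
    rw [hRv, mulVec_mulVec _ Q' Q, hQ', one_mulVec, mulVec_mulVec _ Q' Q, hQ', one_mulVec]
  by_cases h : ∀ B : Matrix (Fin n) (Fin n) ℂ, (∀ g, B * (R g)ᴴᵀ = R (θ g) * B) → B = 0
  · left
    refine ⟨hchar.trans (sum_trace_twisted_eq_zero hU' θ _ h), fun J hJ => ?_⟩
    -- In the unitary coordinates J is composed with complex conjugation; the result is linear, and
    -- its matrix is an intertwiner, which vanishes in this case.
    let f : (Fin n → ℂ) →ₗ[ℂ] (Fin n → ℂ) :=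
      { toFun := fun w => Q *ᵥ J (Q' *ᵥ star w)
        map_add' := fun v w => by rw [star_add, mulVec_add, map_add, mulVec_add]
        map_smul' := fun c v => by
          rw [star_smul, mulVec_smul, map_smulₛₗ, mulVec_smul]
          simp }
    have hf (w) : LinearMap.toMatrix' f *ᵥ w = Q *ᵥ J (Q' *ᵥ star w) :=
      LinearMap.toMatrix'_mulVec f w
    have h1 := h (LinearMap.toMatrix' f) fun g => by
      refine ext_of_mulVec_single fun i => ?_
      rw [← mulVec_mulVec, ← mulVec_mulVec, hf, hf, hstarv, entrywiseConj_entrywiseConj, hRv, hRv,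
        mulVec_mulVec _ Q' Q, hQ', one_mulVec, mulVec_mulVec _ Q' Q, hQ', one_mulVec, hJ]
    refine LinearMap.ext fun v => ?_
    have h2 := hf (star (Q *ᵥ v))
    rw [h1, zero_mulVec, star_star, mulVec_mulVec _ Q' Q, hQ', one_mulVec] at h2
    rw [LinearMap.zero_apply, ← one_mulVec (J v), ← hQ', ← mulVec_mulVec, ← h2, mulVec_zero]
  · right
    push Not at h
    obtain ⟨B₀, hB₀, hne⟩ := h
    obtain ⟨B, ε, hB, hBB, hε, h⟩ := exists_normalized_intertwiner hU' hS hθu hθ hB₀ hne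
    have hε2 : ε * ε = 1 := by rcases h with rfl | rfl <;> norm_num
    have hsum := sum_trace_twisted_of_intertwiner hU' hS hB hBB ε hε hε2
    obtain ⟨J, hJ1, hJ2⟩ := hJ B hB
    rcases h with rfl | rfl
    · left
      refine ⟨by rw [hchar, hsum, one_mul], J, hJ1, fun v => ?_⟩
      rw [hJ2, hε, one_smul, hQu]
    · right
      refine ⟨by rw [hchar, hsum, neg_one_mul], J, hJ1, fun v => ?_⟩
      rw [hJ2, hε, smul_mulVec, mulVec_smul, hQu, neg_one_smul]

end UnitaryMatrix

/-! ### Endomorphism algebras of real representations -/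

section ComplexLinear

variable {V W : Type*} [AddCommGroup V] [Module ℂ V] [AddCommGroup W] [Module ℂ W]

theorem Complex.smul_eq_re_im (c : ℂ) (v : V) : c • v = c.re • v + c.im • (Complex.I • v) := by
  conv_lhs => rw [← Complex.re_add_im c, add_smul, mul_smul]
  rfl

/-- A real linear map that commutes with `I` is complex linear. -/
def LinearMap.ofRealLinear (φ : V →ₗ[ℝ] W) (h : ∀ v, φ (Complex.I • v) = Complex.I • φ v) :
    V →ₗ[ℂ] W where
  toFun := φ
  map_add' := φ.map_add
  map_smul' c v := by
    rw [Complex.smul_eq_re_im c v, map_add, map_smul, map_smul, h, RingHom.id_apply,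
      Complex.smul_eq_re_im c]

/-- A real linear map that anticommutes with `I` is antilinear. -/
def LinearMap.ofRealAntilinear (φ : V →ₗ[ℝ] W)
    (h : ∀ v, φ (Complex.I • v) = -(Complex.I • φ v)) : V →ₛₗ[starRingEnd ℂ] W where
  toFun := φ
  map_add' := φ.map_add
  map_smul' c v := by
    rw [Complex.smul_eq_re_im c v, map_add, map_smul, map_smul, h, Complex.smul_eq_re_im (conj c),
      Complex.conj_re, Complex.conj_im, smul_neg, neg_smul]

/-- An antilinear map, regarded as a real linear map. -/
def LinearMap.antilinearToReal (J : V →ₛₗ[starRingEnd ℂ] W) : V →ₗ[ℝ] W where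
  toFun := J
  map_add' := J.map_add
  map_smul' r v := by
    change J ((r : ℂ) • v) = (r : ℂ) • J v
    rw [map_smulₛₗ, Complex.conj_ofReal]

/-- The quaternion algebra acts on a complex vector space with an antilinear operator of
square `-1`. -/
noncomputable def quaternionAction (J : V →ₛₗ[starRingEnd ℂ] V) (hJ : ∀ v, J (J v) = -v) :
    ℍ[ℝ] →ₐ[ℝ] Module.End ℝ V :=
  QuaternionAlgebra.Basis.liftHom
    { i := Algebra.lsmul ℝ ℝ V Complex.I
      j := LinearMap.antilinearToReal J
      k := Algebra.lsmul ℝ ℝ V Complex.I * LinearMap.antilinearToReal J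
      i_mul_i := by
        rw [← map_mul, Complex.I_mul_I, map_neg, map_one]
        simp
      j_mul_j := LinearMap.ext fun v => by
        change J (J v) = _
        rw [hJ]
        simp
      i_mul_j := rfl
      j_mul_i := LinearMap.ext fun v => by
        change J (Complex.I • v) = _
        rw [map_smulₛₗ]
        simp [LinearMap.antilinearToReal] }

theorem quaternionAction_apply (J : V →ₛₗ[starRingEnd ℂ] V) (hJ : ∀ v, J (J v) = -v) (q : ℍ[ℝ])
    (v : V) : quaternionAction J hJ q v =
      (⟨q.re, q.imI⟩ : ℂ) • v + (⟨q.imJ, q.imK⟩ : ℂ) • J v := by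
  rw [Complex.smul_eq_re_im _ v, Complex.smul_eq_re_im _ (J v), ← add_assoc]
  rfl

end ComplexLinear

namespace Representation

/-- A complex representation, regarded as a real one. -/
def restrictReal {G V : Type*} [Group G] [AddCommGroup V] [Module ℂ V]
    (ρ : Representation ℂ G V) : Representation ℝ G V where
  toFun g := (ρ g).restrictScalars ℝ
  map_one' := by rw [map_one]; rfl
  map_mul' g h := by rw [map_mul]; rfl

/-- By Maschke an invariant subspace is the image of an idempotent of the commutant, and a division
ring has only the idempotents 0 and 1. -/
theorem isIrreducible_of_commutant {G X K : Type*} [Group G] [Finite G] [AddCommGroup X]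
    [Module ℝ X] [Nontrivial X] [DivisionRing K] [Algebra ℝ K] (π : Representation ℝ G X)
    (Φ : K →ₐ[ℝ] Module.End ℝ X)
    (hΦ : ∀ φ : Module.End ℝ X, (∀ g v, φ (π g v) = π g (φ v)) → ∃ a, Φ a = φ) :
    π.IsIrreducible := by
  refine isIrreducible_of_forall_submodule _ fun U hU => ?_
  have := Fintype.ofFinite G
  let τ : Representation ℝ G U :=
    { toFun := fun g => (π g).restrict (hU g)
      map_one' := by ext; simp
      map_mul' := fun g h => by ext; simp }
  obtain ⟨p, hp, hpU⟩ := exists_equivariant_leftInverse τ π U.subtype (fun _ _ => rfl)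
    U.injective_subtype
  obtain ⟨a, ha⟩ := hΦ (U.subtype ∘ₗ p) fun g v => by
    change ((p (π g v) : U) : X) = π g (p v)
    rw [hp]
    rfl
  have hpp : a * a = a := by
    apply Φ.toRingHom.injective
    change Φ (a * a) = Φ a
    rw [map_mul, ha]
    refine LinearMap.ext fun v => ?_
    change ((p (p v : X) : U) : X) = p v
    exact congrArg Subtype.val (hpU (p v))
  rcases IsIdempotentElem.iff_eq_zero_or_one.1 hpp with rfl | rfl
  · left
    rw [Submodule.eq_bot_iff]
    intro x hx
    have h1 := LinearMap.congr_fun ha x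
    rw [map_zero, LinearMap.zero_apply] at h1
    have h2 : p x = ⟨x, hx⟩ := hpU ⟨x, hx⟩
    change 0 = ((p x : U) : X) at h1
    rw [h2] at h1
    exact h1.symm
  · right
    rw [Submodule.eq_top_iff']
    intro x
    have h1 := LinearMap.congr_fun ha x
    rw [map_one, Module.End.one_apply] at h1
    rw [h1]
    exact (p x).2

/-- Isomorphic representations have isomorphic endomorphism algebras. -/
def Equiv.endEquiv {k G V W : Type*} [Field k] [Group G] [AddCommGroup V] [Module k V]
    [AddCommGroup W] [Module k W] {ρ : Representation k G V} {σ : Representation k G W}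
    (e : Equiv ρ σ) : IntertwiningMap ρ ρ ≃ₐ[k] IntertwiningMap σ σ where
  toFun f := (e.toIntertwiningMap.comp f).comp e.symm.toIntertwiningMap
  invFun f := (e.symm.toIntertwiningMap.comp f).comp e.toIntertwiningMap
  left_inv f := DFunLike.ext _ _ fun v => by simp
  right_inv f := DFunLike.ext _ _ fun v => by simp
  map_mul' f g := DFunLike.ext _ _ fun v => by simp
  map_add' f g := DFunLike.ext _ _ fun v => by simp
  commutes' r := DFunLike.ext _ _ fun v => by simp

end Representation

/-! ### Models of the simple ℝG-modules. -/

section LinearEnd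

open Representation

variable {Γ : Type*} [Group Γ] [Finite Γ] {G : Subgroup Γ} {n : ℕ}
  {ρ : Representation ℂ G (Fin n → ℂ)}

/-- Simplicity of the model is a consequence of its commutant being a division ring, so each case
only requires a commutant computation. -/
theorem hasLinearEnd_of_model (hρ : ρ.IsIrreducible) {K : Type} [DivisionRing K] [Algebra ℝ K]
    {X : Type*} [AddCommGroup X] [Module ℝ X] [FiniteDimensional ℝ X] (π : Representation ℝ G X)
    (f : X →ₗ[ℝ] (Fin n → ℂ)) (hf0 : f ≠ 0) (hf : ∀ g v, f (π g v) = ρ g (f v))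
    (Φ : K →ₐ[ℝ] Module.End ℝ X)
    (hΦ : ∀ φ : Module.End ℝ X, (∀ g v, φ (π g v) = π g (φ v)) ↔ ∃ a, Φ a = φ) :
    HasLinearEnd G ρ.character K := by
  let e := (Module.finBasis ℝ X).equivFun
  let σ : Representation ℝ G (Fin (Module.finrank ℝ X) → ℝ) :=
    ((LinearEquiv.conjAlgEquiv ℝ e : _ →* _)).comp π
  have hσ (g v) : σ g v = e (π g (e.symm v)) := rfl
  let Ψ : K →ₐ[ℝ] Module.End ℝ (Fin (Module.finrank ℝ X) → ℝ) :=
    (LinearEquiv.conjAlgEquiv ℝ e).toAlgHom.comp Φ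
  have hΨ (a v) : Ψ a v = e (Φ a (e.symm v)) := rfl
  have hcomm (φ : Module.End ℝ (Fin (Module.finrank ℝ X) → ℝ)) :
      (∀ g v, φ (σ g v) = σ g (φ v)) ↔ ∃ a, Ψ a = φ := by
    have h1 := hΦ ((LinearEquiv.conjAlgEquiv ℝ e).symm φ)
    have h2 (v) : (LinearEquiv.conjAlgEquiv ℝ e).symm φ v = e.symm (φ (e v)) := rfl
    constructor
    · intro h
      obtain ⟨a, ha⟩ := h1.1 fun g v => by
        rw [h2, h2]
        apply e.injective
        have := h g (e v)
        rw [hσ, hσ, e.symm_apply_apply] at this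
        rw [e.apply_symm_apply, this]
      refine ⟨a, LinearMap.ext fun v => ?_⟩
      rw [hΨ, ha, h2, e.apply_symm_apply, e.apply_symm_apply]
    · rintro ⟨a, rfl⟩ g v
      rw [hΨ, hΨ, hσ, hσ, e.symm_apply_apply, e.symm_apply_apply, (hΦ (Φ a)).2 ⟨a, rfl⟩]
  have hne : Nontrivial (Fin (Module.finrank ℝ X) → ℝ) := by
    obtain ⟨x, hx⟩ : ∃ x, f x ≠ 0 := by
      by_contra! h
      exact hf0 (LinearMap.ext h)
    refine ⟨e x, 0, fun h => hx ?_⟩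
    rw [e.map_eq_zero_iff.1 h, map_zero]
  refine ⟨n, ρ, hρ, rfl, Module.finrank ℝ X, σ,
    isIrreducible_of_commutant σ Ψ fun φ h => (hcomm φ).1 h,
    ⟨f ∘ₗ e.symm, fun h => hf0 (LinearMap.ext fun x => ?_), fun g v => ?_⟩, ?_⟩
  · simpa using LinearMap.congr_fun h (e x)
  · change f (e.symm (σ g v)) = ρ g (f (e.symm v))
    rw [hσ, e.symm_apply_apply, hf]
  · let F : K →ₐ[ℝ] IntertwiningMap σ σ :=
      { toFun := fun a => ⟨Ψ a, fun g => LinearMap.ext fun v => (hcomm _).2 ⟨a, rfl⟩ g v⟩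
        map_one' := DFunLike.ext _ _ fun v => by simp
        map_mul' := fun a b => DFunLike.ext _ _ fun v => by simp
        map_zero' := DFunLike.ext _ _ fun v => by simp
        map_add' := fun a b => DFunLike.ext _ _ fun v => by simp
        commutes' := fun r => DFunLike.ext _ _ fun v => by simp }
    refine ⟨(AlgEquiv.ofBijective F ⟨fun a b h => ?_, fun φ => ?_⟩).symm⟩
    · exact Ψ.toRingHom.injective (congrArg IntertwiningMap.toLinearMap h)
    · obtain ⟨a, ha⟩ := (hcomm φ.toLinearMap).1 fun g v =>
        IntertwiningMap.isIntertwining _ _ φ g v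
      exact ⟨a, IntertwiningMap.ext ha⟩

/-- The simple ℝG-module is unique: σ₁ maps to ρ₂ and σ₂ is a direct summand of ρ₂ over ℝ. After
multiplication by a suitable complex number the composite σ₁ → ρ₂ → σ₂ is nonzero, hence an
isomorphism. -/
theorem HasLinearEnd.nonempty_algEquiv {χ : G → ℂ} {K K' : Type} [Ring K] [Algebra ℝ K] [Ring K']
    [Algebra ℝ K'] (h : HasLinearEnd G χ K) (h' : HasLinearEnd G χ K') :
    Nonempty (K ≃ₐ[ℝ] K') := by
  obtain ⟨n₁, ρ₁, hρ₁, hχ₁, d₁, σ₁, hσ₁, ⟨f₁, hf₁, hf₁'⟩, ⟨e₁⟩⟩ := h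
  obtain ⟨n₂, ρ₂, hρ₂, hχ₂, d₂, σ₂, hσ₂, ⟨f₂, hf₂, hf₂'⟩, ⟨e₂⟩⟩ := h'
  obtain ⟨E⟩ := nonempty_equiv_of_character_eq hρ₁ hρ₂ (hχ₁.trans hχ₂.symm)
  have hE (g v) : E (ρ₁ g v) = ρ₂ g (E v) :=
    IntertwiningMap.isIntertwining _ _ E.toIntertwiningMap g v
  have hinj : Function.Injective f₂ :=
    hσ₂.injective_of_ne_zero f₂.toAddMonoidHom (fun g => (ρ₂ g).toAddMonoidHom) hf₂'
      (fun c v hv => by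
        change f₂ v = 0 at hv
        change f₂ (c • v) = 0
        rw [map_smul, hv, smul_zero])
      (fun h => hf₂ (LinearMap.ext fun v => DFunLike.congr_fun h v))
  obtain ⟨p, hp, hpf⟩ := exists_equivariant_leftInverse σ₂ ρ₂.restrictReal f₂ hf₂' hinj
  -- The vectors all of whose complex multiples are killed by p form an invariant complex subspace.
  -- It is not everything, since p is nonzero, so it is 0 and cannot contain the image of σ₁.
  have hex : ∃ c : ℂ, ∃ v, p (c • E (f₁ v)) ≠ 0 := by
    by_contra! hzero
    let U : Submodule ℂ (Fin n₂ → ℂ) :=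
      { carrier := {v | ∀ c : ℂ, p (c • v) = 0}
        add_mem' := fun {a b} ha hb c => by rw [smul_add, map_add, ha, hb, add_zero]
        zero_mem' := fun c => by rw [smul_zero, map_zero]
        smul_mem' := fun c v hv c' => by rw [smul_smul]; exact hv _ }
    obtain ⟨x, hx⟩ : ∃ x, f₁ x ≠ 0 := by
      by_contra! h
      exact hf₁ (LinearMap.ext h)
    rcases hρ₂.eq_bot_or_eq_top_of_forall_mem U fun g v hv c => by
        rw [← map_smul]
        exact (hp g _).trans (by rw [hv c, map_zero]) with hU | hU
    · have : E (f₁ x) ∈ U := fun c => hzero c x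
      rw [hU, Submodule.mem_bot] at this
      exact hx (E.toLinearEquiv.map_eq_zero_iff.1 this)
    · have := hσ₂.nontrivial
      obtain ⟨y, hy⟩ := exists_ne (0 : Fin d₂ → ℝ)
      have h1 : f₂ y ∈ U := by rw [hU]; exact Submodule.mem_top
      have h2 := h1 1
      rw [one_smul, hpf] at h2
      exact hy h2
  obtain ⟨c, v, hcv⟩ := hex
  let h : IntertwiningMap σ₁ σ₂ :=
    ⟨p ∘ₗ (Algebra.lsmul ℝ ℝ (Fin n₂ → ℂ) c) ∘ₗ (E.toLinearEquiv.toLinearMap.restrictScalars ℝ) ∘ₗ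
      f₁, fun g => LinearMap.ext fun v => by
        change p (c • E (f₁ (σ₁ g v))) = σ₂ g (p (c • E (f₁ v)))
        rw [hf₁', hE, ← map_smul]
        exact hp g _⟩
  have hbij := (IsIrreducible.bijective_or_eq_zero h).resolve_right fun h0 =>
    hcv (DFunLike.congr_fun h0 v)
  exact ⟨(e₁.symm.trans (h.ofBijective hbij).endEquiv).trans e₂⟩

-- The complex linear part (φ - iφi)/2 is a scalar by Schur's lemma; the antilinear part (φ + iφi)/2
-- is again equivariant.
omit [Finite Γ] in
theorem exists_smul_eq_of_real_commute (hρ : ρ.IsIrreducible)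
    (φ : (Fin n → ℂ) →ₗ[ℝ] (Fin n → ℂ)) (hφ : ∀ g v, φ (ρ g v) = ρ g (φ v)) :
    ∃ (a : ℂ) (A : (Fin n → ℂ) →ₛₗ[starRingEnd ℂ] (Fin n → ℂ)),
      (∀ g v, A (ρ g v) = ρ g (A v)) ∧ ∀ v, φ v = a • v + A v := by
  let I' : (Fin n → ℂ) →ₗ[ℝ] (Fin n → ℂ) := Algebra.lsmul ℝ ℝ (Fin n → ℂ) Complex.I
  have hII (v : Fin n → ℂ) : Complex.I • Complex.I • v = -v := by
    rw [smul_smul, Complex.I_mul_I, neg_one_smul]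
  let L := LinearMap.ofRealLinear ((2⁻¹ : ℝ) • (φ - I' ∘ₗ φ ∘ₗ I')) fun v => by
    change (2⁻¹ : ℝ) • (φ (Complex.I • v) - Complex.I • φ (Complex.I • Complex.I • v)) =
      Complex.I • (2⁻¹ : ℝ) • (φ v - Complex.I • φ (Complex.I • v))
    rw [smul_comm Complex.I (2⁻¹ : ℝ), smul_sub Complex.I, hII, hII, map_neg, smul_neg, sub_neg_eq_add,
      sub_neg_eq_add, add_comm]
  let A := LinearMap.ofRealAntilinear ((2⁻¹ : ℝ) • (φ + I' ∘ₗ φ ∘ₗ I')) fun v => by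
    change (2⁻¹ : ℝ) • (φ (Complex.I • v) + Complex.I • φ (Complex.I • Complex.I • v)) =
      -(Complex.I • (2⁻¹ : ℝ) • (φ v + Complex.I • φ (Complex.I • v)))
    rw [smul_comm Complex.I (2⁻¹ : ℝ), smul_add Complex.I, hII, hII, map_neg, smul_neg,
      ← smul_neg (2⁻¹ : ℝ), neg_add, neg_neg, add_comm]
  have hL (v) : L v = (2⁻¹ : ℝ) • (φ v - Complex.I • φ (Complex.I • v)) := rfl
  have hA (v) : A v = (2⁻¹ : ℝ) • (φ v + Complex.I • φ (Complex.I • v)) := rfl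
  have hr (r : ℝ) (g v) : ρ g (r • v) = r • ρ g v := (ρ g).map_smul (r : ℂ) v
  have hc (g v) : ρ g (Complex.I • v) = Complex.I • ρ g v := (ρ g).map_smul _ v
  obtain ⟨a, ha⟩ := hρ.exists_eq_smul L fun g v => by
    rw [hL, hL, hr, map_sub, hc, hφ, ← hc g v, hφ]
  refine ⟨a, A, fun g v => ?_, fun v => ?_⟩
  · rw [hA, hA, hr, map_add, hc, hφ, ← hc g v, hφ]
  · rw [← ha, hL, hA, ← smul_add]
    have : φ v - Complex.I • φ (Complex.I • v) + (φ v + Complex.I • φ (Complex.I • v)) =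
        (2 : ℝ) • φ v := by
      rw [two_smul]
      abel
    rw [this, smul_smul, inv_mul_cancel₀ two_ne_zero, one_smul]

theorem hasLinearEnd_complex (hρ : ρ.IsIrreducible)
    (hJ : ∀ J : (Fin n → ℂ) →ₛₗ[starRingEnd ℂ] (Fin n → ℂ),
      (∀ g v, J (ρ g v) = ρ g (J v)) → J = 0) : HasLinearEnd G ρ.character ℂ := by
  refine hasLinearEnd_of_model hρ ρ.restrictReal LinearMap.id ?_ (fun _ _ => rfl)
    (Algebra.lsmul ℝ ℝ (Fin n → ℂ)) fun φ => ⟨fun h => ?_, ?_⟩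
  · intro h
    have := hρ.nontrivial
    obtain ⟨v, hv⟩ := exists_ne (0 : Fin n → ℂ)
    exact hv (LinearMap.congr_fun h v)
  · obtain ⟨a, A, hA, h⟩ := exists_smul_eq_of_real_commute hρ φ h
    refine ⟨a, LinearMap.ext fun v => ?_⟩
    rw [h, hJ A hA]
    simp
  · rintro ⟨a, rfl⟩ g v
    exact ((ρ g).map_smul a v).symm

/-- The space of ρ stays simple over ℝ. For an antilinear intertwiner A the composite AJ is linear,
hence scalar, so A is a multiple of J and the commutant is ℂ + ℂJ. -/
theorem hasLinearEnd_quaternion (hρ : ρ.IsIrreducible)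
    (J : (Fin n → ℂ) →ₛₗ[starRingEnd ℂ] (Fin n → ℂ)) (hJ : ∀ g v, J (ρ g v) = ρ g (J v))
    (hJJ : ∀ v, J (J v) = -v) : HasLinearEnd G ρ.character ℍ[ℝ] := by
  refine hasLinearEnd_of_model hρ ρ.restrictReal LinearMap.id ?_ (fun _ _ => rfl)
    (quaternionAction J hJJ) fun φ => ⟨fun h => ?_, ?_⟩
  · intro h
    have := hρ.nontrivial
    obtain ⟨v, hv⟩ := exists_ne (0 : Fin n → ℂ)
    exact hv (LinearMap.congr_fun h v)
  · obtain ⟨a, A, hA, h⟩ := exists_smul_eq_of_real_commute hρ φ h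
    obtain ⟨b, hb⟩ := hρ.exists_eq_smul (A.comp J) fun g v => by
      rw [LinearMap.comp_apply, LinearMap.comp_apply, hJ, hA]
    refine ⟨⟨a.re, a.im, (-b).re, (-b).im⟩, LinearMap.ext fun v => ?_⟩
    refine (quaternionAction_apply J hJJ _ v).trans ?_
    rw [h]
    have h1 := hb (J v)
    rw [LinearMap.comp_apply, hJJ, map_neg] at h1
    rw [← neg_neg (A v), h1, ← neg_smul]
  · rintro ⟨a, rfl⟩ g v
    rw [quaternionAction_apply, quaternionAction_apply]
    change _ = ρ g _
    rw [map_add, map_smul, map_smul, ← hJ]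
    rfl

/-- Here J is a real structure: the space is X + iX for the fixed space X of J. An equivariant
endomorphism of X extends complex linearly, is a scalar by Schur's lemma, and the scalar is real
because X is preserved. -/
theorem hasLinearEnd_real (hρ : ρ.IsIrreducible)
    (J : (Fin n → ℂ) →ₛₗ[starRingEnd ℂ] (Fin n → ℂ)) (hJ : ∀ g v, J (ρ g v) = ρ g (J v))
    (hJJ : ∀ v, J (J v) = v) : HasLinearEnd G ρ.character ℝ := by
  let J' := LinearMap.antilinearToReal J
  have hJ' (v) : J' v = J v := rfl
  have hr (r : ℝ) (g v) : ρ g (r • v) = r • ρ g v := (ρ g).map_smul (r : ℂ) v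
  have hII (v : Fin n → ℂ) : Complex.I • Complex.I • v = -v := by
    rw [smul_smul, Complex.I_mul_I, neg_one_smul]
  let X : Submodule ℝ (Fin n → ℂ) := LinearMap.eqLocus J' LinearMap.id
  have hX (v) : v ∈ X ↔ J v = v := Iff.rfl
  let P : (Fin n → ℂ) →ₗ[ℝ] X := LinearMap.codRestrict X ((2⁻¹ : ℝ) • (LinearMap.id + J')) fun v => by
    rw [hX]
    change J' ((2⁻¹ : ℝ) • (v + J' v)) = (2⁻¹ : ℝ) • (v + J' v)
    rw [map_smul, map_add, hJ', hJ', hJJ, add_comm]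
  have hP (v) : (P v : Fin n → ℂ) = (2⁻¹ : ℝ) • (v + J v) := rfl
  have hdec (v) : v = (P v : Fin n → ℂ) + Complex.I • (P (-(Complex.I • v)) : Fin n → ℂ) := by
    rw [hP, hP, map_neg, map_smulₛₗ, Complex.conj_I, neg_smul, neg_neg, smul_comm Complex.I,
      smul_add Complex.I, smul_neg, hII, neg_neg, hII, ← smul_add]
    have : v + J v + (v + -J v) = (2 : ℝ) • v := by
      rw [two_smul]
      abel
    rw [this, smul_smul, inv_mul_cancel₀ two_ne_zero, one_smul]
  let π : Representation ℝ G X :=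
    { toFun := fun g => (ρ.restrictReal g).restrict fun v hv => by
        rw [hX] at hv ⊢
        change J (ρ g v) = ρ g v
        rw [hJ, hv]
      map_one' := by ext; simp
      map_mul' := fun g h => by ext; simp }
  have hπ (g v) : ((π g v : X) : Fin n → ℂ) = ρ g v := rfl
  have hPg (g v) : P (ρ g v) = π g (P v) := Subtype.ext (by
    rw [hP, hπ, hP, hr, map_add, hJ])
  have hPX (v : X) : P v = v := Subtype.ext (by
    rw [hP, (hX v).1 v.2, ← two_smul ℝ, smul_smul, inv_mul_cancel₀ two_ne_zero, one_smul])
  refine hasLinearEnd_of_model hρ π X.subtype ?_ (fun _ _ => rfl)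
    (Algebra.ofId ℝ (Module.End ℝ X)) fun φ => ⟨fun h => ?_, ?_⟩
  · intro h
    have := hρ.nontrivial
    obtain ⟨v, hv⟩ := exists_ne (0 : Fin n → ℂ)
    have h1 (x : X) : (x : Fin n → ℂ) = 0 := LinearMap.congr_fun h x
    apply hv
    rw [hdec v, h1, h1, smul_zero, add_zero]
  · let I' : (Fin n → ℂ) →ₗ[ℝ] (Fin n → ℂ) := Algebra.lsmul ℝ ℝ (Fin n → ℂ) Complex.I
    -- The complexification of φ: P gives the real part of v and P(-iv) its imaginary part.
    let ψ : (Fin n → ℂ) →ₗ[ℂ] (Fin n → ℂ) := LinearMap.ofRealLinear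
      (X.subtype ∘ₗ φ ∘ₗ P + I' ∘ₗ X.subtype ∘ₗ φ ∘ₗ P ∘ₗ (-I')) fun v => by
        change ((φ (P (Complex.I • v)) : X) : Fin n → ℂ) +
            Complex.I • ((φ (P (-(Complex.I • Complex.I • v))) : X) : Fin n → ℂ) =
          Complex.I • (((φ (P v) : X) : Fin n → ℂ) +
            Complex.I • ((φ (P (-(Complex.I • v))) : X) : Fin n → ℂ))
        rw [smul_add, hII, hII, neg_neg, map_neg, map_neg, Submodule.coe_neg, neg_neg, add_comm]
    have hψ (v) : ψ v = ((φ (P v) : X) : Fin n → ℂ) +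
      Complex.I • ((φ (P (-(Complex.I • v))) : X) : Fin n → ℂ) := rfl
    obtain ⟨c, hc⟩ := hρ.exists_eq_smul ψ fun g v => by
      rw [hψ, hψ, hPg, h, ← map_smul, ← map_neg, hPg, h, map_add, map_smul, hπ, hπ]
    have hφc (x : X) : ((φ x : X) : Fin n → ℂ) = c • (x : Fin n → ℂ) := by
      rw [← hc, hψ, hPX]
      have h1 : P (-(Complex.I • (x : Fin n → ℂ))) = 0 := Subtype.ext (by
        rw [hP, map_neg, map_smulₛₗ, (hX x).1 x.2, Complex.conj_I, neg_smul, neg_neg,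
          neg_add_cancel, smul_zero]
        rfl)
      rw [h1, map_zero, Submodule.coe_zero, smul_zero, add_zero]
    refine ⟨c.re, LinearMap.ext fun x => Subtype.ext ?_⟩
    rw [hφc]
    have h1 : conj c • (x : Fin n → ℂ) = c • (x : Fin n → ℂ) := by
      have h2 := (hX _).1 (φ x).2
      rw [hφc, map_smulₛₗ, (hX x).1 x.2] at h2
      exact h2
    have h3 : (c.re : ℂ) • (x : Fin n → ℂ) = c • (x : Fin n → ℂ) := by
      have h4 : (c.re : ℂ) = 2⁻¹ * (c + conj c) := by
        rw [Complex.add_conj]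
        push_cast
        ring
      rw [h4, mul_smul, add_smul, h1, ← two_smul ℂ, smul_smul, inv_mul_cancel₀ two_ne_zero,
        one_smul]
    exact h3
  · rintro ⟨a, rfl⟩ g v
    exact ((π g).map_smul a v).symm

/-- The Frobenius–Schur indicator determines the type of the simple real representation. -/
theorem linearEnd_trichotomy [Fintype G] (hρ : ρ.IsIrreducible) :
    (∑ g, ρ.character (g * g) = 0 ∧ HasLinearEnd G ρ.character ℂ) ∨
    (∑ g, ρ.character (g * g) = Fintype.card G ∧ HasLinearEnd G ρ.character ℝ) ∨
    (∑ g, ρ.character (g * g) = -Fintype.card G ∧ HasLinearEnd G ρ.character ℍ[ℝ]) := by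
  have h := hρ.antilinear_trichotomy (MonoidHom.id G) 1 rfl (by simp)
  simp only [MonoidHom.id_apply, mul_one, map_one, Module.End.one_apply] at h
  rcases h with ⟨h, hJ⟩ | ⟨h, J, hJ, hJJ⟩ | ⟨h, J, hJ, hJJ⟩
  · exact Or.inl ⟨h, hasLinearEnd_complex hρ hJ⟩
  · exact Or.inr (Or.inl ⟨h, hasLinearEnd_real hρ J hJ hJJ⟩)
  · exact Or.inr (Or.inr ⟨h, hasLinearEnd_quaternion hρ J hJ hJJ⟩)

end LinearEnd

theorem Subgroup.exists_notMem_of_index_eq_two {Γ : Type*} [Group Γ] {G : Subgroup Γ}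
    (hG : G.index = 2) : ∃ z, z ∉ G := by
  by_contra! h
  rw [(Subgroup.eq_top_iff' G).2 h, Subgroup.index_top] at hG
  exact absurd hG (by norm_num)

/-! ### Endomorphism algebras of Real representations -/

namespace RealRep

variable {Γ : Type*} [Group Γ] {G : Subgroup Γ} {d e : ℕ}

theorem toHom_mul_apply (τ : RealRep G d) (g h : Γ) (v : Fin d → ℂ) :
    τ.toHom (g * h) v = τ.toHom g (τ.toHom h v) := by
  rw [map_mul]
  rfl

theorem toHom_one_apply (τ : RealRep G d) (v : Fin d → ℂ) : τ.toHom 1 v = v := by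
  rw [map_one]
  rfl

theorem toHom_self_apply_inv (τ : RealRep G d) (g : Γ) (v : Fin d → ℂ) :
    τ.toHom g (τ.toHom g⁻¹ v) = v := by
  rw [← toHom_mul_apply, mul_inv_cancel, toHom_one_apply]

/-- The restriction of a Real representation to `G`. -/
def res (τ : RealRep G d) : Representation ℂ G (Fin d → ℂ) where
  toFun g :=
    { toFun := τ.toHom g
      map_add' := map_add _
      map_smul' := τ.map_smul_of_mem g g.2 }
  map_one' := LinearMap.ext fun v => toHom_one_apply τ v
  map_mul' g h := LinearMap.ext fun v => toHom_mul_apply τ g h v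

/-- A `G`-equivariant map between Real representations, plus its conjugate by an element of the
second coset. -/
def symmetrize (τ : RealRep G d) (σ : RealRep G e) {z : Γ} (hz : z ∉ G)
    (h : (Fin d → ℂ) →ₗ[ℂ] (Fin e → ℂ)) : (Fin d → ℂ) →ₗ[ℂ] (Fin e → ℂ) where
  toFun v := h v + σ.toHom z (h (τ.toHom z⁻¹ v))
  map_add' v w := by
    simp only [map_add]
    abel
  map_smul' c v := by
    rw [τ.map_smul_of_notMem _ (fun h => hz (by simpa using h)), map_smul, map_smul,
      σ.map_smul_of_notMem _ hz, Complex.conj_conj, smul_add, RingHom.id_apply]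

theorem symmetrize_apply (τ : RealRep G d) (σ : RealRep G e) {z : Γ} (hz : z ∉ G)
    (h : (Fin d → ℂ) →ₗ[ℂ] (Fin e → ℂ)) (v) :
    symmetrize τ σ hz h v = h v + σ.toHom z (h (τ.toHom z⁻¹ v)) := rfl

/-- This is an average over the two cosets: an element of G preserves both summands and an element
of the second coset exchanges them. -/
theorem symmetrize_equivariant (hG : G.index = 2) (τ : RealRep G d) (σ : RealRep G e) {z : Γ}
    (hz : z ∉ G) (h : (Fin d → ℂ) →ₗ[ℂ] (Fin e → ℂ))
    (hh : ∀ g ∈ G, ∀ v, h (τ.toHom g v) = σ.toHom g (h v)) (g : Γ) (v : Fin d → ℂ) :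
    symmetrize τ σ hz h (τ.toHom g v) = σ.toHom g (symmetrize τ σ hz h v) := by
  have hz' : z⁻¹ ∉ G := by simpa using hz
  rw [symmetrize_apply, symmetrize_apply, map_add, ← toHom_mul_apply, ← toHom_mul_apply]
  by_cases hg : g ∈ G
  · have h1 : z⁻¹ * g * z ∈ G := by
      have := Subgroup.normal_of_index_eq_two hG
      simpa using this.conj_mem g hg z⁻¹
    rw [hh g hg]
    congr 1
    have h2 : τ.toHom (z⁻¹ * g) v = τ.toHom (z⁻¹ * g * z) (τ.toHom z⁻¹ v) := by
      rw [← toHom_mul_apply]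
      congr 2
      group
    rw [h2, hh _ h1, ← toHom_mul_apply]
    congr 2
    group
  · have h1 : z⁻¹ * g ∈ G := by
      rw [Subgroup.mul_mem_iff_of_index_two hG]
      simp [hz, hg]
    have h3 : g * z ∈ G := by
      rw [Subgroup.mul_mem_iff_of_index_two hG]
      simp [hz, hg]
    rw [add_comm]
    congr 1
    · rw [hh _ h1, ← toHom_mul_apply]
      congr 2
      group
    · rw [← hh _ h3, ← toHom_mul_apply]
      congr 3
      group

/-- Maschke in two stages: the projection is averaged over G and then over the two cosets, giving an
idempotent of the endomorphism algebra with the prescribed image. -/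
theorem isSimple_of_endAlg (hG : G.index = 2) [Finite Γ] {K : Type*} [DivisionRing K] [Algebra ℝ K]
    (τ : RealRep G d) [Nontrivial (Fin d → ℂ)] (Φ : K →ₐ[ℝ] Module.End ℂ (Fin d → ℂ))
    (hΦ : ∀ φ ∈ τ.endAlg, ∃ a, Φ a = φ) : τ.IsSimple := by
  refine ⟨inferInstance, fun U hU => ?_⟩
  obtain ⟨z, hz⟩ := Subgroup.exists_notMem_of_index_eq_two hG
  let ρ : Representation ℂ G U :=
    { toFun := fun g => (τ.res g).restrict (hU g)
      map_one' := by ext; simp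
      map_mul' := fun g h => LinearMap.ext fun v => Subtype.ext (by
        change τ.res (g * h) v = τ.res g (τ.res h v)
        rw [map_mul]
        rfl) }
  obtain ⟨p, hp, hpU⟩ := Representation.exists_equivariant_leftInverse ρ τ.res U.subtype
    (fun _ _ => rfl) U.injective_subtype
  have hq : ∀ g ∈ G, ∀ v, (U.subtype ∘ₗ p) (τ.toHom g v) = τ.toHom g ((U.subtype ∘ₗ p) v) := by
    intro g hg v
    exact congrArg Subtype.val (hp ⟨g, hg⟩ v)
  let q : (Fin d → ℂ) →ₗ[ℂ] (Fin d → ℂ) := (2⁻¹ : ℝ) • symmetrize τ τ hz (U.subtype ∘ₗ p)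
  have hqv (v) : q v = (2⁻¹ : ℝ) • ((p v : Fin d → ℂ) + τ.toHom z (p (τ.toHom z⁻¹ v))) := rfl
  have hqmem : q ∈ τ.endAlg := τ.endAlg.smul_mem
    (show symmetrize τ τ hz (U.subtype ∘ₗ p) ∈ τ.endAlg from
      fun g v => symmetrize_equivariant hG τ τ hz _ hq g v) _
  have hqU (v) : q v ∈ U := by
    rw [hqv]
    exact U.smul_of_tower_mem _ (U.add_mem (p v).2 (hU _ _ (p _).2))
  have hqid (v) (hv : v ∈ U) : q v = v := by
    have h1 : (p v : Fin d → ℂ) = v := congrArg Subtype.val (hpU ⟨v, hv⟩)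
    have h2 : (p (τ.toHom z⁻¹ v) : Fin d → ℂ) = τ.toHom z⁻¹ v :=
      congrArg Subtype.val (hpU ⟨_, hU z⁻¹ v hv⟩)
    rw [hqv, h1, h2, toHom_self_apply_inv, ← two_smul ℝ, smul_smul, inv_mul_cancel₀ two_ne_zero,
      one_smul]
  obtain ⟨a, ha⟩ := hΦ q hqmem
  have haa : a * a = a := by
    apply Φ.toRingHom.injective
    change Φ (a * a) = Φ a
    rw [map_mul, ha]
    exact LinearMap.ext fun v => hqid _ (hqU v)
  rcases IsIdempotentElem.iff_eq_zero_or_one.1 haa with rfl | rfl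
  · left
    rw [Submodule.eq_bot_iff]
    intro x hx
    rw [← hqid x hx, ← ha, map_zero, LinearMap.zero_apply]
  · right
    rw [Submodule.eq_top_iff']
    intro x
    have h1 := hqU x
    rwa [← ha, map_one, Module.End.one_apply] at h1

/-- Isomorphic Real representations have isomorphic endomorphism algebras. -/
def endEquiv (τ : RealRep G d) (σ : RealRep G e) (E : (Fin d → ℂ) ≃ₗ[ℂ] (Fin e → ℂ))
    (hE : ∀ g v, E (τ.toHom g v) = σ.toHom g (E v)) : τ.endAlg ≃ₐ[ℝ] σ.endAlg :=
  have hE' (g v) : E.symm (σ.toHom g v) = τ.toHom g (E.symm v) := by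
    apply E.injective
    rw [hE, E.apply_symm_apply, E.apply_symm_apply]
  { toFun := fun f => ⟨E.toLinearMap ∘ₗ f.1 ∘ₗ E.symm.toLinearMap, fun g v => by
      change E (f.1 (E.symm (σ.toHom g v))) = σ.toHom g (E (f.1 (E.symm v)))
      rw [hE', f.2, hE]⟩
    invFun := fun f => ⟨E.symm.toLinearMap ∘ₗ f.1 ∘ₗ E.toLinearMap, fun g v => by
      change E.symm (f.1 (E (τ.toHom g v))) = τ.toHom g (E.symm (f.1 (E v)))
      rw [hE, f.2, hE']⟩
    left_inv := fun f => Subtype.ext (LinearMap.ext fun v => by simp)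
    right_inv := fun f => Subtype.ext (LinearMap.ext fun v => by simp)
    map_mul' := fun f g => Subtype.ext (LinearMap.ext fun v => by simp)
    map_add' := fun f g => Subtype.ext (LinearMap.ext fun v => by simp)
    commutes' := fun r => Subtype.ext (LinearMap.ext fun v => by
      change E (((r : ℂ) • E.symm v)) = (r : ℂ) • v
      rw [map_smul, E.apply_symm_apply]) }

theorem IsSimple.bijective {τ : RealRep G d} {σ : RealRep G e} (hτ : τ.IsSimple) (hσ : σ.IsSimple)
    (f : (Fin d → ℂ) →ₗ[ℂ] (Fin e → ℂ)) (hf : ∀ g v, f (τ.toHom g v) = σ.toHom g (f v))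
    (hf0 : f ≠ 0) : Function.Bijective f := by
  constructor
  · rw [← LinearMap.ker_eq_bot]
    refine (hτ.2 (LinearMap.ker f) fun g v hv => ?_).resolve_right fun h =>
      hf0 (LinearMap.ker_eq_top.1 h)
    rw [LinearMap.mem_ker] at hv ⊢
    rw [hf, hv, map_zero]
  · rw [← LinearMap.range_eq_top]
    refine (hσ.2 (LinearMap.range f) fun g v hv => ?_).resolve_left fun h =>
      hf0 (LinearMap.range_eq_bot.1 h)
    obtain ⟨w, rfl⟩ := hv
    exact ⟨τ.toHom g w, hf g w⟩

end RealRep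

/-- The simple Real representation is unique: the `G`-map h from τ₁ to τ₂ through the common
constituent is symmetrized to a `Γ`-map, to which Schur's lemma applies. -/
theorem HasRealEnd.nonempty_algEquiv {Γ : Type*} [Group Γ] [Finite Γ] {G : Subgroup Γ}
    (hG : G.index = 2) {χ : G → ℂ} {K K' : Type} [Ring K] [Algebra ℝ K] [Ring K']
    [Algebra ℝ K'] (h : HasRealEnd G χ K) (h' : HasRealEnd G χ K') : Nonempty (K ≃ₐ[ℝ] K') := by
  obtain ⟨n₁, ρ₁, hρ₁, hχ₁, d₁, τ₁, hτ₁, ⟨f₁, hf₁, hf₁'⟩, ⟨e₁⟩⟩ := h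
  obtain ⟨n₂, ρ₂, hρ₂, hχ₂, d₂, τ₂, hτ₂, ⟨f₂, hf₂, hf₂'⟩, ⟨e₂⟩⟩ := h'
  obtain ⟨E⟩ := Representation.nonempty_equiv_of_character_eq hρ₁ hρ₂ (hχ₁.trans hχ₂.symm)
  have hE (g v) : E (ρ₁ g v) = ρ₂ g (E v) :=
    Representation.IntertwiningMap.isIntertwining _ _ E.toIntertwiningMap g v
  obtain ⟨z, hz⟩ := Subgroup.exists_notMem_of_index_eq_two hG
  have hinj : Function.Injective f₁ :=
    hρ₁.injective_of_ne_zero f₁.toAddMonoidHom (fun g => (τ₁.res g).toAddMonoidHom) hf₁'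
      (fun c v hv => by
        change f₁ v = 0 at hv
        change f₁ (c • v) = 0
        rw [map_smul, hv, smul_zero])
      (fun h => hf₁ (LinearMap.ext fun v => DFunLike.congr_fun h v))
  obtain ⟨p, hp, hpf⟩ := Representation.exists_equivariant_leftInverse ρ₁ τ₁.res f₁ hf₁' hinj
  let h : (Fin d₁ → ℂ) →ₗ[ℂ] (Fin d₂ → ℂ) := f₂ ∘ₗ E.toLinearEquiv.toLinearMap ∘ₗ p
  have hv (v) : h v = f₂ (E (p v)) := rfl
  have hh (c : ℂ) : ∀ g ∈ G, ∀ v, (c • h) (τ₁.toHom g v) = τ₂.toHom g ((c • h) v) := by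
    intro g hg v
    rw [LinearMap.smul_apply, LinearMap.smul_apply, τ₂.map_smul_of_mem g hg, hv, hv]
    have h1 : p (τ₁.toHom g v) = ρ₁ ⟨g, hg⟩ (p v) := hp ⟨g, hg⟩ v
    rw [h1, hE, hf₂']
  -- Symmetrizing h gives h + h', with h' its conjugate by z, and symmetrizing ih gives i(h - h').
  -- If both vanished, so would h.
  obtain ⟨c, hc⟩ : ∃ c : ℂ, RealRep.symmetrize τ₁ τ₂ hz (c • h) ≠ 0 := by
    by_contra! h0
    apply hf₂
    refine LinearMap.ext fun w => ?_
    have h1 := LinearMap.congr_fun (h0 1) (f₁ (E.symm w))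
    have h2 := LinearMap.congr_fun (h0 Complex.I) (f₁ (E.symm w))
    rw [RealRep.symmetrize_apply, LinearMap.zero_apply] at h1 h2
    rw [LinearMap.smul_apply, LinearMap.smul_apply, τ₂.map_smul_of_notMem z hz, hv, hpf,
      E.apply_symm_apply] at h1 h2
    rw [map_one, one_smul, one_smul] at h1
    rw [Complex.conj_I, neg_smul, ← sub_eq_add_neg, ← smul_sub] at h2
    have h3 := (smul_eq_zero.1 h2).resolve_left Complex.I_ne_zero
    rw [← sub_eq_zero.1 h3, ← two_smul ℂ] at h1
    exact (smul_eq_zero.1 h1).resolve_left two_ne_zero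
  have heq := RealRep.symmetrize_equivariant hG τ₁ τ₂ hz _ (hh c)
  have hbij := hτ₁.bijective hτ₂ _ heq hc
  exact ⟨(e₁.symm.trans (RealRep.endEquiv τ₁ τ₂ (LinearEquiv.ofBijective _ hbij) heq)).trans e₂⟩

/-! ### Real representations built from a `G`-action and one antilinear operator. -/

section RealEnd

variable {Γ : Type*} [Group Γ] {G : Subgroup Γ}

/-- Conjugation by an element of `Γ`, as an endomorphism of the subgroup `G` of index two. -/
def conjHom (hG : G.index = 2) (z : Γ) : G →* G where
  toFun g := ⟨z * g * z⁻¹, (Subgroup.normal_of_index_eq_two hG).conj_mem g g.2 z⟩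
  map_one' := Subtype.ext (by simp)
  map_mul' g h := Subtype.ext (by simp)

/-- The square of an element of `Γ`, as an element of the subgroup `G` of index two. -/
def squareIn (hG : G.index = 2) (z : Γ) : G := ⟨z * z, Subgroup.mul_self_mem_of_index_two hG z⟩

theorem Subgroup.mul_inv_mem_of_index_two (hG : G.index = 2) {z : Γ} (hz : z ∉ G) {g : Γ}
    (hg : g ∉ G) : g * z⁻¹ ∈ G := by
  rw [Subgroup.mul_mem_iff_of_index_two hG]
  simp [hg, hz]

variable {X : Type*} [AddCommGroup X] [Module ℂ X] (hG : G.index = 2) {z : Γ} (hz : z ∉ G)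
  (π : Representation ℂ G X) (Z : X →ₛₗ[starRingEnd ℂ] X)

open Classical in
/-- The operators by which the elements of `Γ` act, given an action of `G` and the action of an
element `z` of the second coset. -/
noncomputable def extendFun (g : Γ) : X →+ X :=
  if hg : g ∈ G then (π ⟨g, hg⟩).toAddMonoidHom
  else (π ⟨g * z⁻¹, Subgroup.mul_inv_mem_of_index_two hG hz hg⟩).toAddMonoidHom.comp
    Z.toAddMonoidHom

theorem extendFun_of_mem {g : Γ} (hg : g ∈ G) (x : X) :
    extendFun hG hz π Z g x = π ⟨g, hg⟩ x := by
  rw [extendFun, dif_pos hg]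
  rfl

theorem extendFun_of_notMem {g : Γ} (hg : g ∉ G) (x : X) :
    extendFun hG hz π Z g x =
      π ⟨g * z⁻¹, Subgroup.mul_inv_mem_of_index_two hG hz hg⟩ (Z x) := by
  rw [extendFun, dif_neg hg]
  rfl

variable (hZ : ∀ g x, Z (π g x) = π (conjHom hG z g) (Z x))
  (hZZ : ∀ x, Z (Z x) = π (squareIn hG z) x)

/-- The action of `Γ` defined by an action of `G` and by the action of an element `z` of the second
coset. -/
noncomputable def extendAction : Γ →* AddMonoid.End X where
  toFun := extendFun hG hz π Z
  map_one' := AddMonoidHom.ext fun x => by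
    rw [extendFun_of_mem hG hz π Z G.one_mem]
    change π 1 x = x
    rw [map_one, Module.End.one_apply]
  map_mul' g h := AddMonoidHom.ext fun x => by
    change _ = extendFun hG hz π Z g (extendFun hG hz π Z h x)
    have hgh := Subgroup.mul_mem_iff_of_index_two hG (a := g) (b := h)
    by_cases hg : g ∈ G <;> by_cases hh : h ∈ G
    · rw [extendFun_of_mem _ _ _ _ (hgh.2 (iff_of_true hg hh)), extendFun_of_mem _ _ _ _ hg,
        extendFun_of_mem _ _ _ _ hh, ← Module.End.mul_apply, ← map_mul]
      rfl
    · rw [extendFun_of_notMem _ _ _ _ (by simp [hgh, hg, hh]), extendFun_of_mem _ _ _ _ hg,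
        extendFun_of_notMem _ _ _ _ hh, ← Module.End.mul_apply, ← map_mul]
      congr 2
      exact Subtype.ext (mul_assoc _ _ _)
    · rw [extendFun_of_notMem _ _ _ _ (by simp [hgh, hg, hh]), extendFun_of_notMem _ _ _ _ hg,
        extendFun_of_mem _ _ _ _ hh, hZ, ← Module.End.mul_apply, ← map_mul]
      congr 2
      exact Subtype.ext (by simp [conjHom, mul_assoc])
    · rw [extendFun_of_mem _ _ _ _ (hgh.2 (iff_of_false hg hh)), extendFun_of_notMem _ _ _ _ hg,
        extendFun_of_notMem _ _ _ _ hh, hZ, hZZ, ← Module.End.mul_apply, ← Module.End.mul_apply,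
        ← map_mul, ← map_mul]
      congr 2
      exact Subtype.ext (by simp [conjHom, squareIn, mul_assoc])

-- Since Γ is the union of G and Gz, an action is fixed by G and Z, subject to the relations for
-- zgz⁻¹ and z², and commuting with Γ means commuting with G and Z. Simplicity again follows from
-- the commutant being a division ring.
include hz hZ hZZ in
theorem hasRealEnd_of_model [Finite Γ] [FiniteDimensional ℂ X] {n : ℕ}
    {ρ : Representation ℂ G (Fin n → ℂ)}
    (hρ : ρ.IsIrreducible) {K : Type} [DivisionRing K] [Algebra ℝ K]
    (f : (Fin n → ℂ) →ₗ[ℂ] X) (hf0 : f ≠ 0) (hf : ∀ g v, f (ρ g v) = π g (f v))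
    (Φ : K →ₐ[ℝ] Module.End ℂ X)
    (hΦ : ∀ φ : Module.End ℂ X,
      ((∀ g x, φ (π g x) = π g (φ x)) ∧ ∀ x, φ (Z x) = Z (φ x)) ↔ ∃ a, Φ a = φ) :
    HasRealEnd G ρ.character K := by
  let T := extendAction hG hz π Z hZ hZZ
  have hmem {g : Γ} (hg : g ∉ G) : g * z⁻¹ ∈ G := Subgroup.mul_inv_mem_of_index_two hG hz hg
  have hT1 {g : Γ} (hg : g ∈ G) (x : X) : T g x = π ⟨g, hg⟩ x :=
    extendFun_of_mem hG hz π Z hg x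
  have hT2 {g : Γ} (hg : g ∉ G) (x : X) : T g x = π ⟨g * z⁻¹, hmem hg⟩ (Z x) :=
    extendFun_of_notMem hG hz π Z hg x
  have hTz (x : X) : T z x = Z x := by
    rw [hT2 hz]
    have : (⟨z * z⁻¹, hmem hz⟩ : G) = 1 := Subtype.ext (mul_inv_cancel z)
    rw [this, map_one, Module.End.one_apply]
  have hcomm (φ : Module.End ℂ X) : (∀ g x, φ (T g x) = T g (φ x)) ↔ ∃ a, Φ a = φ := by
    rw [← hΦ]
    constructor
    · intro h
      refine ⟨fun g x => ?_, fun x => ?_⟩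
      · have := h g x
        rwa [hT1 g.2, hT1 g.2] at this
      · have := h z x
        rwa [hTz, hTz] at this
    · rintro ⟨h1, h2⟩ g x
      by_cases hg : g ∈ G
      · rw [hT1 hg, hT1 hg, h1]
      · rw [hT2 hg, hT2 hg, h1, h2]
  let d := Module.finrank ℂ X
  let E : X ≃ₗ[ℂ] (Fin d → ℂ) := (Module.finBasis ℂ X).equivFun
  let τ : RealRep G d :=
    { toHom :=
        { toFun := fun g => (E.toLinearMap.toAddMonoidHom.comp (T g)).comp
            E.symm.toLinearMap.toAddMonoidHom
          map_one' := AddMonoidHom.ext fun v => by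
            change E (T 1 (E.symm v)) = v
            rw [map_one]
            exact E.apply_symm_apply v
          map_mul' := fun g h => AddMonoidHom.ext fun v => by
            change E (T (g * h) (E.symm v)) = E (T g (E.symm (E (T h (E.symm v)))))
            rw [map_mul, E.symm_apply_apply]
            rfl }
      map_smul_of_mem := fun g hg c v => by
        change E (T g (E.symm (c • v))) = c • E (T g (E.symm v))
        rw [hT1 hg, hT1 hg, map_smul, map_smul, map_smul]
      map_smul_of_notMem := fun g hg c v => by
        change E (T g (E.symm (c • v))) = conj c • E (T g (E.symm v))
        rw [hT2 hg, hT2 hg, map_smul, map_smulₛₗ, map_smul, map_smul] }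
  have hτ (g v) : τ.toHom g v = E (T g (E.symm v)) := rfl
  let Ψ : K →ₐ[ℝ] Module.End ℂ (Fin d → ℂ) := (E.conjAlgEquiv ℝ).toAlgHom.comp Φ
  have hΨ (a v) : Ψ a v = E (Φ a (E.symm v)) := rfl
  have hend (φ : Module.End ℂ (Fin d → ℂ)) : φ ∈ τ.endAlg ↔ ∃ a, Ψ a = φ := by
    have h1 := hcomm ((E.conjAlgEquiv ℝ).symm φ)
    have h2 (v) : (E.conjAlgEquiv ℝ).symm φ v = E.symm (φ (E v)) := rfl
    constructor
    · intro h
      obtain ⟨a, ha⟩ := h1.1 fun g v => by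
        rw [h2, h2]
        apply E.injective
        have := h g (E v)
        rw [hτ, hτ, E.symm_apply_apply] at this
        rw [E.apply_symm_apply, this]
      refine ⟨a, LinearMap.ext fun v => ?_⟩
      rw [hΨ, ha, h2, E.apply_symm_apply, E.apply_symm_apply]
    · rintro ⟨a, rfl⟩ g v
      rw [hΨ, hΨ, hτ, hτ, E.symm_apply_apply, E.symm_apply_apply, (hcomm (Φ a)).2 ⟨a, rfl⟩]
  obtain ⟨v, hv⟩ : ∃ v, f v ≠ 0 := by
    by_contra! h
    exact hf0 (LinearMap.ext h)
  have hne : Nontrivial (Fin d → ℂ) := ⟨E (f v), 0, fun h => hv (E.map_eq_zero_iff.1 h)⟩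
  refine ⟨n, ρ, hρ, rfl, d, τ, τ.isSimple_of_endAlg hG Ψ fun φ hφ => (hend φ).1 hφ,
    ⟨E.toLinearMap ∘ₗ f, fun h => hv (E.map_eq_zero_iff.1 (LinearMap.congr_fun h v)),
      fun g w => ?_⟩, ?_⟩
  · change E (f (ρ g w)) = τ.toHom g (E (f w))
    rw [hτ, E.symm_apply_apply, hf, hT1 g.2]
  · refine ⟨(AlgEquiv.ofBijective (Ψ.codRestrict τ.endAlg fun a => (hend _).2 ⟨a, rfl⟩)
      ⟨fun a b h => ?_, fun φ => ?_⟩).symm⟩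
    · exact Ψ.toRingHom.injective (congrArg Subtype.val h)
    · obtain ⟨a, ha⟩ := (hend φ.1).1 φ.2
      exact ⟨a, Subtype.ext ha⟩

end RealEnd

/-! ### Models of the simple Real representations. -/

section RealEndCases

variable {Γ : Type*} [Group Γ] [Finite Γ] {G : Subgroup Γ} {n : ℕ}
  {ρ : Representation ℂ G (Fin n → ℂ)}

/-- The operator J itself serves as the action of z. A scalar commutes with the antilinear J only if
it is real. -/
theorem hasRealEnd_real (hG : G.index = 2) {z : Γ} (hz : z ∉ G) (hρ : ρ.IsIrreducible)
    (J : (Fin n → ℂ) →ₛₗ[starRingEnd ℂ] (Fin n → ℂ))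
    (hJ : ∀ g v, J (ρ g v) = ρ (conjHom hG z g) (J v))
    (hJJ : ∀ v, J (J v) = ρ (squareIn hG z) v) : HasRealEnd G ρ.character ℝ := by
  have := hρ.nontrivial
  obtain ⟨v₀, hv₀⟩ := exists_ne (0 : Fin n → ℂ)
  refine hasRealEnd_of_model hG hz ρ J hJ hJJ hρ LinearMap.id
    (fun h => hv₀ (LinearMap.congr_fun h v₀)) (fun _ _ => rfl)
    (Algebra.ofId ℝ (Module.End ℂ (Fin n → ℂ))) fun φ => ⟨fun ⟨h1, h2⟩ => ?_, ?_⟩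
  · obtain ⟨c, hc⟩ := hρ.exists_eq_smul φ h1
    have hJv : J v₀ ≠ 0 := fun h => hv₀ (by
      have h3 := hJJ v₀
      rw [h, map_zero] at h3
      have h4 := congrArg (ρ (squareIn hG z)⁻¹) h3
      rw [map_zero, ← Module.End.mul_apply, ← map_mul, inv_mul_cancel, map_one] at h4
      exact h4.symm)
    have h3 : c = conj c := by
      have h4 := h2 v₀
      rw [hc, hc, map_smulₛₗ] at h4
      exact smul_left_injective ℂ hJv h4
    refine ⟨c.re, LinearMap.ext fun v => ?_⟩
    rw [hc, ← Complex.conj_eq_iff_re.1 h3.symm]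
    rfl
  · rintro ⟨a, rfl⟩
    refine ⟨fun g v => ((ρ g).map_smul (a : ℂ) v).symm, fun v => ?_⟩
    change (a : ℂ) • J v = J ((a : ℂ) • v)
    rw [map_smulₛₗ, Complex.conj_ofReal]

/-- The action of the quaternions on the double of a complex vector space. -/
noncomputable def quaternionActionProd (V : Type*) [AddCommGroup V] [Module ℂ V] :
    ℍ[ℝ] →ₐ[ℝ] Module.End ℂ (V × V) :=
  QuaternionAlgebra.Basis.liftHom
    { i := LinearMap.prodMap (Complex.I • LinearMap.id) (-(Complex.I • LinearMap.id))
      j := LinearMap.prod (LinearMap.snd ℂ V V) (-LinearMap.fst ℂ V V)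
      k := LinearMap.prod (Complex.I • LinearMap.snd ℂ V V) (Complex.I • LinearMap.fst ℂ V V)
      i_mul_i := LinearMap.ext fun x => Prod.ext (by simp [smul_smul]) (by simp [smul_smul])
      j_mul_j := LinearMap.ext fun x => Prod.ext (by simp) (by simp)
      i_mul_j := LinearMap.ext fun x => Prod.ext (by simp) (by simp)
      j_mul_i := LinearMap.ext fun x => Prod.ext (by simp) (by simp) }

theorem quaternionActionProd_apply {V : Type*} [AddCommGroup V] [Module ℂ V] (q : ℍ[ℝ])
    (x : V × V) : quaternionActionProd V q x =
      ((⟨q.re, q.imI⟩ : ℂ) • x.1 + (⟨q.imJ, q.imK⟩ : ℂ) • x.2,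
        -((conj ⟨q.imJ, q.imK⟩ : ℂ) • x.1) + (conj ⟨q.re, q.imI⟩ : ℂ) • x.2) := by
  have h : quaternionActionProd V q x = q.re • x + q.imI • (Complex.I • x.1, -(Complex.I • x.2)) +
    q.imJ • (x.2, -x.1) + q.imK • (Complex.I • x.2, Complex.I • x.1) := rfl
  rw [h, Complex.smul_eq_re_im ⟨q.re, q.imI⟩ x.1, Complex.smul_eq_re_im (conj ⟨_, _⟩) x.1,
    Complex.smul_eq_re_im ⟨q.imJ, q.imK⟩ x.2, Complex.smul_eq_re_im (conj ⟨_, _⟩) x.2]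
  refine Prod.ext ?_ ?_
  · simp only [Prod.fst_add, Prod.smul_fst]
    abel
  · simp only [Prod.snd_add, Prod.smul_snd, Complex.conj_re, Complex.conj_im, smul_neg, neg_smul]
    abel

/-- The square of J has the wrong sign for an action of z, which Z(x, y) = (-Jy, Jx) on the double
corrects. Endomorphisms over G are 2 × 2 complex matrices; commuting with Z forces the rows (a, b)
and (-conj b, conj a), a copy of ℍ. -/
theorem hasRealEnd_quaternion (hG : G.index = 2) {z : Γ} (hz : z ∉ G) (hρ : ρ.IsIrreducible)
    (J : (Fin n → ℂ) →ₛₗ[starRingEnd ℂ] (Fin n → ℂ))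
    (hJ : ∀ g v, J (ρ g v) = ρ (conjHom hG z g) (J v))
    (hJJ : ∀ v, J (J v) = -ρ (squareIn hG z) v) : HasRealEnd G ρ.character ℍ[ℝ] := by
  have := hρ.nontrivial
  obtain ⟨v₀, hv₀⟩ := exists_ne (0 : Fin n → ℂ)
  have hJv : J v₀ ≠ 0 := fun h => hv₀ (by
    have h3 := hJJ v₀
    rw [h, map_zero, zero_eq_neg] at h3
    have h4 := congrArg (ρ (squareIn hG z)⁻¹) h3
    rw [map_zero, ← Module.End.mul_apply, ← map_mul, inv_mul_cancel, map_one] at h4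
    exact h4)
  let π : Representation ℂ G ((Fin n → ℂ) × (Fin n → ℂ)) := ρ.prod ρ
  have hπ (g x) : π g x = (ρ g x.1, ρ g x.2) := rfl
  let Z : ((Fin n → ℂ) × (Fin n → ℂ)) →ₛₗ[starRingEnd ℂ] ((Fin n → ℂ) × (Fin n → ℂ)) :=
    { toFun := fun x => (-J x.2, J x.1)
      map_add' := fun x y => Prod.ext
        (by simp only [Prod.snd_add, map_add, Prod.fst_add]; abel) (by simp)
      map_smul' := fun c x => Prod.ext (by simp) (by simp) }
  have hZ (x) : Z x = (-J x.2, J x.1) := rfl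
  refine hasRealEnd_of_model hG hz π Z (fun g x => ?_) (fun x => ?_) hρ
    (LinearMap.inl ℂ _ _) (fun h => hv₀ (congrArg Prod.fst (LinearMap.congr_fun h v₀)))
    (fun g v => ?_) (quaternionActionProd (Fin n → ℂ)) fun φ => ⟨fun ⟨h1, h2⟩ => ?_, ?_⟩
  · simp only [hZ, hπ, hJ, map_neg]
  · simp only [hZ, hπ, hJJ, map_neg, neg_neg]
  · simp [hπ]
  · have hl (g v) : π g (v, 0) = (ρ g v, 0) := by rw [hπ, map_zero]
    have hr (g v) : π g (0, v) = (0, ρ g v) := by rw [hπ, map_zero]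
    obtain ⟨a, ha⟩ := hρ.exists_eq_smul (LinearMap.fst ℂ _ _ ∘ₗ φ ∘ₗ LinearMap.inl ℂ _ _)
      fun g v => by
        change (φ (ρ g v, 0)).1 = ρ g (φ (v, 0)).1
        rw [← hl, h1]
        rfl
    obtain ⟨b, hb⟩ := hρ.exists_eq_smul (LinearMap.fst ℂ _ _ ∘ₗ φ ∘ₗ LinearMap.inr ℂ _ _)
      fun g v => by
        change (φ (0, ρ g v)).1 = ρ g (φ (0, v)).1
        rw [← hr, h1]
        rfl
    obtain ⟨c, hc⟩ := hρ.exists_eq_smul (LinearMap.snd ℂ _ _ ∘ₗ φ ∘ₗ LinearMap.inl ℂ _ _)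
      fun g v => by
        change (φ (ρ g v, 0)).2 = ρ g (φ (v, 0)).2
        rw [← hl, h1]
        rfl
    obtain ⟨d, hd⟩ := hρ.exists_eq_smul (LinearMap.snd ℂ _ _ ∘ₗ φ ∘ₗ LinearMap.inr ℂ _ _)
      fun g v => by
        change (φ (0, ρ g v)).2 = ρ g (φ (0, v)).2
        rw [← hr, h1]
        rfl
    have hφl (v) : φ (v, 0) = (a • v, c • v) := Prod.ext (ha v) (hc v)
    have hφr (v) : φ (0, v) = (b • v, d • v) := Prod.ext (hb v) (hd v)
    have hφ (x) : φ x = (a • x.1 + b • x.2, c • x.1 + d • x.2) := by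
      have : x = (x.1, 0) + (0, x.2) := by simp
      conv_lhs => rw [this]
      rw [map_add, hφl, hφr]
      rfl
    have h3 := h2 (v₀, 0)
    rw [hZ, hZ, hφ, hφ, map_zero, neg_zero, smul_zero, smul_zero, zero_add, zero_add, smul_zero,
      smul_zero, add_zero, add_zero, map_smulₛₗ, map_smulₛₗ, ← neg_smul] at h3
    have h4 : b = -conj c := smul_left_injective ℂ hJv (congrArg Prod.fst h3)
    have h5 : d = conj a := smul_left_injective ℂ hJv (congrArg Prod.snd h3)
    refine ⟨⟨a.re, a.im, b.re, b.im⟩, LinearMap.ext fun x => ?_⟩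
    refine (quaternionActionProd_apply _ x).trans ?_
    have h6 : c = -conj b := by rw [h4, map_neg, Complex.conj_conj, neg_neg]
    rw [hφ, h5, h6, neg_smul]
  · rintro ⟨q, rfl⟩
    refine ⟨fun g x => ?_, fun x => ?_⟩
    · rw [quaternionActionProd_apply, quaternionActionProd_apply]
      simp only [hπ, map_add, map_neg, map_smul]
    · rw [quaternionActionProd_apply, quaternionActionProd_apply]
      simp only [hZ, map_add, map_neg, map_smulₛₗ, Complex.conj_conj, smul_neg, neg_add, neg_neg]
      refine Prod.ext ?_ ?_ <;> exact add_comm _ _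

/-- The model is the sum of ρ and ρ', the complex conjugate of its twist by z, with z exchanging the
two. A homomorphism from ρ to ρ' would be an antilinear intertwiner, so there is none, and the
commutant consists of the pairs (a, conj a). -/
theorem hasRealEnd_complex (hG : G.index = 2) {z : Γ} (hz : z ∉ G) (hρ : ρ.IsIrreducible)
    (hJ : ∀ J : (Fin n → ℂ) →ₛₗ[starRingEnd ℂ] (Fin n → ℂ),
      (∀ g v, J (ρ g v) = ρ (conjHom hG z g) (J v)) → J = 0) : HasRealEnd G ρ.character ℂ := by
  have := hρ.nontrivial
  obtain ⟨v₀, hv₀⟩ := exists_ne (0 : Fin n → ℂ)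
  let ρ' : Representation ℂ G (Fin n → ℂ) :=
    { toFun := fun g =>
        { toFun := fun v => star (ρ (conjHom hG z⁻¹ g) (star v))
          map_add' := fun v w => by rw [star_add, map_add, star_add]
          map_smul' := fun c v => by
            rw [star_smul, map_smul, star_smul, star_star, RingHom.id_apply] }
      map_one' := LinearMap.ext fun v => by
        change star (ρ (conjHom hG z⁻¹ 1) (star v)) = v
        rw [map_one, map_one, Module.End.one_apply, star_star]
      map_mul' := fun g h => LinearMap.ext fun v => by
        change star (ρ (conjHom hG z⁻¹ (g * h)) (star v)) =
          star (ρ (conjHom hG z⁻¹ g) (star (star (ρ (conjHom hG z⁻¹ h) (star v)))))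
        rw [map_mul, map_mul, star_star]
        rfl }
  have hρ' (g v) : ρ' g v = star (ρ (conjHom hG z⁻¹ g) (star v)) := rfl
  have hcc (g : G) : conjHom hG z⁻¹ (conjHom hG z g) = g := Subtype.ext (by
    simp [conjHom, mul_assoc])
  have hu : conjHom hG z⁻¹ (squareIn hG z) = squareIn hG z := Subtype.ext (by
    simp [conjHom, squareIn, mul_assoc])
  have huz (g : G) : squareIn hG z * conjHom hG z⁻¹ g = conjHom hG z g * squareIn hG z :=
    Subtype.ext (by simp [conjHom, squareIn, mul_assoc])
  let π : Representation ℂ G ((Fin n → ℂ) × (Fin n → ℂ)) := ρ.prod ρ'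
  have hπ (g x) : π g x = (ρ g x.1, ρ' g x.2) := rfl
  let Z : ((Fin n → ℂ) × (Fin n → ℂ)) →ₛₗ[starRingEnd ℂ] ((Fin n → ℂ) × (Fin n → ℂ)) :=
    { toFun := fun x => (ρ (squareIn hG z) (star x.2), star x.1)
      map_add' := fun x y => Prod.ext (by simp) (by simp)
      map_smul' := fun c x => Prod.ext
        (by simp only [Prod.smul_snd, star_smul, map_smul, Prod.smul_fst]; rfl)
        (by simp only [Prod.smul_snd, star_smul, Prod.smul_fst]; rfl) }
  have hZ (x) : Z x = (ρ (squareIn hG z) (star x.2), star x.1) := rfl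
  let Φ : ℂ →ₐ[ℝ] Module.End ℂ ((Fin n → ℂ) × (Fin n → ℂ)) :=
    { toFun := fun a => LinearMap.prodMap (a • LinearMap.id) (conj a • LinearMap.id)
      map_one' := LinearMap.ext fun x => Prod.ext (by simp) (by simp)
      map_mul' := fun a b => LinearMap.ext fun x =>
        Prod.ext (by
          change (a * b) • x.1 = a • b • x.1
          rw [mul_smul]) (by
          change conj (a * b) • x.2 = conj a • conj b • x.2
          rw [map_mul, mul_smul])
      map_zero' := LinearMap.ext fun x => Prod.ext (by simp) (by simp)
      map_add' := fun a b => LinearMap.ext fun x =>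
        Prod.ext (by simp [add_smul]) (by simp [add_smul])
      commutes' := fun r => LinearMap.ext fun x => Prod.ext rfl (by
        change conj (r : ℂ) • x.2 = (r : ℂ) • x.2
        rw [Complex.conj_ofReal]) }
  have hΦ (a x) : Φ a x = (a • x.1, conj a • x.2) := rfl
  refine hasRealEnd_of_model hG hz π Z (fun g x => ?_) (fun x => ?_) hρ
    (LinearMap.inl ℂ _ _) (fun h => hv₀ (congrArg Prod.fst (LinearMap.congr_fun h v₀)))
    (fun g v => ?_) Φ fun φ => ⟨fun ⟨h1, h2⟩ => ?_, ?_⟩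
  · rw [hZ, hZ, hπ, hπ, hρ', hρ', star_star, star_star, hcc, ← Module.End.mul_apply,
      ← Module.End.mul_apply, ← map_mul, ← map_mul, huz]
  · rw [hZ, hZ, hπ, hρ', star_star, hu]
  · simp [hπ]
  · have hl (g v) : π g (v, 0) = (ρ g v, 0) := by rw [hπ, map_zero]
    have hr (g v) : π g (0, v) = (0, ρ' g v) := by rw [hπ, map_zero]
    obtain ⟨a, ha⟩ := hρ.exists_eq_smul (LinearMap.fst ℂ _ _ ∘ₗ φ ∘ₗ LinearMap.inl ℂ _ _)
      fun g v => by
        change (φ (ρ g v, 0)).1 = ρ g (φ (v, 0)).1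
        rw [← hl, h1]
        rfl
    -- Applying Z to the off-diagonal component gives an antilinear map of the kind excluded by
    -- `hJ`.
    have hm : ∀ v, (φ (v, 0)).2 = 0 := by
      have hJ0 := hJ
        { toFun := fun v => ρ (squareIn hG z) (star (φ (v, 0)).2)
          map_add' := fun v w => by
            have : ((v + w, 0) : (Fin n → ℂ) × (Fin n → ℂ)) = (v, 0) + (w, 0) := by simp
            rw [this, map_add, Prod.snd_add, star_add, map_add]
          map_smul' := fun c v => by
            have : ((c • v, 0) : (Fin n → ℂ) × (Fin n → ℂ)) = c • (v, 0) := by simp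
            rw [this, map_smul, Prod.smul_snd, star_smul, map_smul]
            rfl } fun g v => by
          change ρ (squareIn hG z) (star (φ (ρ g v, 0)).2) =
            ρ (conjHom hG z g) (ρ (squareIn hG z) (star (φ (v, 0)).2))
          rw [← hl, h1, hπ, hρ', star_star, ← Module.End.mul_apply, ← Module.End.mul_apply,
            ← map_mul, ← map_mul, huz]
      intro v
      have h3 : ρ (squareIn hG z) (star (φ (v, 0)).2) = 0 := LinearMap.congr_fun hJ0 v
      have h4 := congrArg (ρ (squareIn hG z)⁻¹) h3
      rw [map_zero, ← Module.End.mul_apply, ← map_mul, inv_mul_cancel, map_one,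
        Module.End.one_apply, star_eq_zero] at h4
      exact h4
    have hφl (v) : φ (v, 0) = (a • v, 0) := Prod.ext (ha v) (hm v)
    -- The second summand is the image under Z of the first, so commutation with Z determines φ
    -- there.
    have hφr (v) : φ (0, v) = (0, conj a • v) := by
      have h3 := h2 (star v, 0)
      rw [hφl, hZ, hZ] at h3
      simpa using h3
    refine ⟨a, LinearMap.ext fun x => ?_⟩
    have : x = (x.1, 0) + (0, x.2) := by simp
    conv_rhs => rw [this]
    rw [map_add, hφl, hφr, hΦ]
    simp
  · rintro ⟨a, rfl⟩
    refine ⟨fun g x => ?_, fun x => ?_⟩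
    · simp only [hΦ, hπ, map_smul]
    · simp only [hΦ, hZ, star_smul, map_smul]
      refine Prod.ext ?_ rfl
      simp

-- The second coset is Gz, and (gz)² = g · zgz⁻¹ · z².
omit [Finite Γ] in
theorem sum_notMem_sq [Fintype G] (hG : G.index = 2) {z : Γ} (hz : z ∉ G)
    [Fintype {x : Γ // x ∉ G}] {M : Type*} [AddCommMonoid M] (χ : G → M) :
    ∑ x : {x : Γ // x ∉ G}, χ (squareIn hG x.1) =
      ∑ g : G, χ (g * conjHom hG z g * squareIn hG z) := by
  refine (Fintype.sum_equiv
    { toFun := fun g => ⟨(g : Γ) * z, fun h => hz ((G.mul_mem_cancel_left g.2).1 h)⟩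
      invFun := fun x => ⟨x.1 * z⁻¹, Subgroup.mul_inv_mem_of_index_two hG hz x.2⟩
      left_inv := fun g => by simp
      right_inv := fun x => by simp } _ _ fun g => ?_).symm
  congr 1
  exact Subtype.ext (by simp [conjHom, squareIn, mul_assoc])

/-- The Real Frobenius–Schur indicator determines the type of the simple Real representation. -/
theorem realEnd_trichotomy [Fintype G] [Fintype {x : Γ // x ∉ G}] (hG : G.index = 2)
    (hρ : ρ.IsIrreducible) :
    (∑ x : {x : Γ // x ∉ G}, ρ.character (squareIn hG x.1) = 0 ∧ HasRealEnd G ρ.character ℂ) ∨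
    (∑ x : {x : Γ // x ∉ G}, ρ.character (squareIn hG x.1) = Fintype.card G ∧
      HasRealEnd G ρ.character ℝ) ∨
    (∑ x : {x : Γ // x ∉ G}, ρ.character (squareIn hG x.1) = -Fintype.card G ∧
      HasRealEnd G ρ.character ℍ[ℝ]) := by
  obtain ⟨z, hz⟩ := Subgroup.exists_notMem_of_index_eq_two hG
  rw [sum_notMem_sq hG hz]
  rcases hρ.antilinear_trichotomy (conjHom hG z) (squareIn hG z)
      (Subtype.ext (by simp [conjHom, squareIn, mul_assoc]))
      (fun g => Subtype.ext (by simp [conjHom, squareIn, mul_assoc])) with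
    ⟨h, hJ⟩ | ⟨h, J, hJ, hJJ⟩ | ⟨h, J, hJ, hJJ⟩
  · exact Or.inl ⟨h, hasRealEnd_complex hG hz hρ hJ⟩
  · exact Or.inr (Or.inl ⟨h, hasRealEnd_real hG hz hρ J hJ hJJ⟩)
  · exact Or.inr (Or.inr ⟨h, hasRealEnd_quaternion hG hz hρ J hJ hJJ⟩)

end RealEndCases

/-! ### Indicators and Dyson types -/

theorem isEmpty_real_algEquiv_complex : IsEmpty (ℝ ≃ₐ[ℝ] ℂ) :=
  ⟨fun e => by simpa [Complex.finrank_real_complex] using e.toLinearEquiv.finrank_eq⟩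

theorem isEmpty_real_algEquiv_quaternion : IsEmpty (ℝ ≃ₐ[ℝ] ℍ[ℝ]) :=
  ⟨fun e => by simpa [Quaternion.finrank_eq_four] using e.toLinearEquiv.finrank_eq⟩

theorem isEmpty_complex_algEquiv_quaternion : IsEmpty (ℂ ≃ₐ[ℝ] ℍ[ℝ]) :=
  ⟨fun e => by
    simpa [Complex.finrank_real_complex, Quaternion.finrank_eq_four] using
      e.toLinearEquiv.finrank_eq⟩

/-- Three mutually exclusive cases, recorded by an integer. -/
theorem exists_indicator {A B C : Prop} {S N : ℂ} (h : S = 0 ∧ B ∨ S = N ∧ A ∨ S = -N ∧ C)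
    (hAB : A → B → False) (hAC : A → C → False) (hBC : B → C → False) :
    ∃ e : ℤ, S = N * e ∧ (A ↔ e = 1) ∧ (B ↔ e = 0) ∧ (C ↔ e = -1) ∧ (e = 0 ∨ e = 1 ∨ e = -1) := by
  rcases h with ⟨h, hb⟩ | ⟨h, ha⟩ | ⟨h, hc⟩
  · exact ⟨0, by simp [h], by simpa using fun a => hAB a hb, by simpa using hb,
      by simpa using hBC hb, by simp⟩
  · exact ⟨1, by simp [h], by simpa using ha, by simpa using hAB ha, by simpa using hAC ha, by simp⟩
  · exact ⟨-1, by simp [h], by simpa using fun a => hAC a hc, by simpa using fun b => hBC b hc,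
      by simpa using hc, by simp⟩

section Types

variable {Γ : Type*} [Group Γ] [Finite Γ] {G : Subgroup Γ}

/-- The numerical data of a finite group with a Real structure: the degrees of the irreducible
characters, their Frobenius–Schur indicators, and their Real indicators. -/
structure RealData (hG : G.index = 2) extends IrreducibleList G where
  lin : Fin card → ℤ
  real : Fin card → ℤ
  sum_lin : ∀ i, ∑ᶠ g : G, (rep i).character (g * g) = Nat.card G * lin i
  sum_real : ∀ i, ∑ᶠ x : {x : Γ // x ∉ G}, (rep i).character (squareIn hG x.1) =
    Nat.card G * real i
  hasLinearEnd_real_iff : ∀ i, HasLinearEnd G (rep i).character ℝ ↔ lin i = 1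
  hasLinearEnd_complex_iff : ∀ i, HasLinearEnd G (rep i).character ℂ ↔ lin i = 0
  hasLinearEnd_quaternion_iff : ∀ i, HasLinearEnd G (rep i).character ℍ[ℝ] ↔ lin i = -1
  hasRealEnd_real_iff : ∀ i, HasRealEnd G (rep i).character ℝ ↔ real i = 1
  hasRealEnd_quaternion_iff : ∀ i, HasRealEnd G (rep i).character ℍ[ℝ] ↔ real i = -1
  lin_mem : ∀ i, lin i = 0 ∨ lin i = 1 ∨ lin i = -1
  real_mem : ∀ i, real i = 0 ∨ real i = 1 ∨ real i = -1

/-- The endomorphism algebras are unique up to isomorphism and ℝ, ℂ, ℍ have different dimensions, so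
the implications of the two trichotomies become equivalences. -/
theorem nonempty_realData (hG : G.index = 2) : Nonempty (RealData hG) := by
  classical
  have := Fintype.ofFinite Γ
  obtain ⟨L⟩ := nonempty_irreducibleList G
  have hlin (i) := exists_indicator (linearEnd_trichotomy (L.isIrreducible i))
    (fun h h' => isEmpty_real_algEquiv_complex.elim' (h.nonempty_algEquiv h').some)
    (fun h h' => isEmpty_real_algEquiv_quaternion.elim' (h.nonempty_algEquiv h').some)
    (fun h h' => isEmpty_complex_algEquiv_quaternion.elim' (h.nonempty_algEquiv h').some)
  have hreal (i) := exists_indicator (realEnd_trichotomy hG (L.isIrreducible i))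
    (fun h h' => isEmpty_real_algEquiv_complex.elim' (h.nonempty_algEquiv hG h').some)
    (fun h h' => isEmpty_real_algEquiv_quaternion.elim' (h.nonempty_algEquiv hG h').some)
    (fun h h' => isEmpty_complex_algEquiv_quaternion.elim' (h.nonempty_algEquiv hG h').some)
  choose lin h1 h2 h3 h4 h5 using hlin
  choose real h1' h2' h3' h4' h5' using hreal
  refine ⟨{ L with
    lin := lin
    real := real
    sum_lin := fun i => ?_
    sum_real := fun i => ?_
    hasLinearEnd_real_iff := h2
    hasLinearEnd_complex_iff := h3
    hasLinearEnd_quaternion_iff := h4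
    hasRealEnd_real_iff := h2'
    hasRealEnd_quaternion_iff := h4'
    lin_mem := h5
    real_mem := h5' }⟩
  · rw [finsum_eq_sum_of_fintype, h1, Nat.card_eq_fintype_card]
  · rw [finsum_eq_sum_of_fintype, h1', Nat.card_eq_fintype_card]

namespace RealData

variable {hG : G.index = 2} (D : RealData hG)

open Classical in
theorem numDyson_eq (t : DysonType) :
    numDyson G t = ∑ i, if HasDysonType G (D.rep i).character t then 1 else 0 := by
  rw [← Finset.card_filter, ← Set.ncard_coe_finset, numDyson,
    ← Set.ncard_image_of_injective _ D.character_injective]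
  congr 1
  ext χ
  simp only [Set.mem_ofPred_eq, Finset.coe_filter, Finset.mem_univ, true_and, Set.mem_image]
  constructor
  · rintro ⟨⟨n, ρ, hρ, rfl⟩, h⟩
    obtain ⟨i, hi⟩ := D.exists_character_eq hρ
    exact ⟨i, hi ▸ h, hi⟩
  · rintro ⟨i, h, rfl⟩
    exact ⟨⟨_, _, D.isIrreducible i, rfl⟩, h⟩

/-- The types I, V, IX are those with F_d = ℝ, one for each value of F_a. -/
theorem numDyson_real_eq :
    numDyson G .I + numDyson G .V + numDyson G .IX = ∑ i, if D.real i = 1 then 1 else 0 := by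
  classical
  rw [D.numDyson_eq, D.numDyson_eq, D.numDyson_eq, ← Finset.sum_add_distrib,
    ← Finset.sum_add_distrib]
  refine Finset.sum_congr rfl fun i _ => ?_
  simp only [HasDysonType, D.hasLinearEnd_real_iff, D.hasLinearEnd_complex_iff,
    D.hasLinearEnd_quaternion_iff, D.hasRealEnd_real_iff]
  rcases D.lin_mem i with h | h | h <;> simp [h]

theorem numDyson_quaternion_eq :
    numDyson G .II + numDyson G .VI + numDyson G .VIII = ∑ i, if D.real i = -1 then 1 else 0 := by
  classical
  rw [D.numDyson_eq, D.numDyson_eq, D.numDyson_eq, ← Finset.sum_add_distrib,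
    ← Finset.sum_add_distrib]
  refine Finset.sum_congr rfl fun i _ => ?_
  simp only [HasDysonType, D.hasLinearEnd_real_iff, D.hasLinearEnd_complex_iff,
    D.hasLinearEnd_quaternion_iff, D.hasRealEnd_quaternion_iff]
  rcases D.lin_mem i with h | h | h <;> simp [h]

/-- Squaring `lin` gives 0 for F_a = ℂ and 1 for F_a = ℝ or ℍ, which leaves I and IX among the types
with F_d = ℝ. -/
theorem numDyson_real_eq' :
    numDyson G .I + numDyson G .IX = ∑ i, if D.lin i ^ 2 * D.real i = 1 then 1 else 0 := by
  classical
  rw [D.numDyson_eq, D.numDyson_eq, ← Finset.sum_add_distrib]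
  refine Finset.sum_congr rfl fun i _ => ?_
  simp only [HasDysonType, D.hasLinearEnd_real_iff, D.hasLinearEnd_quaternion_iff,
    D.hasRealEnd_real_iff]
  rcases D.lin_mem i with h | h | h <;> simp [h]

theorem numDyson_quaternion_eq' :
    numDyson G .II + numDyson G .VIII = ∑ i, if D.lin i ^ 2 * D.real i = -1 then 1 else 0 := by
  classical
  rw [D.numDyson_eq, D.numDyson_eq, ← Finset.sum_add_distrib]
  refine Finset.sum_congr rfl fun i _ => ?_
  simp only [HasDysonType, D.hasLinearEnd_real_iff, D.hasLinearEnd_quaternion_iff,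
    D.hasRealEnd_quaternion_iff]
  rcases D.lin_mem i with h | h | h <;> simp [h]

/-- The trivial character. -/
theorem exists_trivial : ∃ i, D.deg i = 1 ∧ D.lin i = 1 ∧ D.real i = 1 := by
  classical
  have := Fintype.ofFinite Γ
  have hirr : (Representation.trivial ℂ G (Fin 1 → ℂ)).IsIrreducible :=
    Representation.isIrreducible_of_forall_submodule _ fun U _ => by
      have : Module.finrank ℂ U = 0 ∨ Module.finrank ℂ U = 1 := by
        have h1 := U.finrank_le
        rw [Module.finrank_fin_fun] at h1
        omega
      rcases this with h | h
      · exact Or.inl (Submodule.finrank_eq_zero.1 h)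
      · exact Or.inr (Submodule.eq_top_of_finrank_eq (by rw [h, Module.finrank_fin_fun]))
  obtain ⟨i, hi⟩ := D.exists_character_eq hirr
  have hχ (g) : (D.rep i).character g = 1 := by
    rw [hi]
    simp [Representation.character]
  have hN : (Nat.card G : ℂ) ≠ 0 := by exact_mod_cast Nat.card_pos.ne'
  refine ⟨i, ?_, ?_, ?_⟩
  · have := hχ 1
    rw [Representation.char_one, Module.finrank_fin_fun] at this
    exact_mod_cast this
  · have := D.sum_lin i
    simp_rw [hχ] at this
    rw [finsum_eq_sum_of_fintype, Finset.sum_const, Finset.card_univ, ← Nat.card_eq_fintype_card,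
      nsmul_eq_mul] at this
    exact_mod_cast (mul_left_cancel₀ hN this).symm
  · have := D.sum_real i
    simp_rw [hχ] at this
    rw [finsum_eq_sum_of_fintype] at this
    obtain ⟨z, hz⟩ := Subgroup.exists_notMem_of_index_eq_two hG
    rw [sum_notMem_sq hG hz (fun _ => (1 : ℂ)), Finset.sum_const, Finset.card_univ,
      ← Nat.card_eq_fintype_card, nsmul_eq_mul] at this
    exact_mod_cast (mul_left_cancel₀ hN this).symm

end RealData

end Types

/-! ### Numbers of solutions of word equations -/

theorem sum_prod_ofFn {R T : Type*} [Semiring R] [Fintype T] (f : T → R) (m : ℕ) :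
    ∑ p : Fin m → T, (List.ofFn fun i => f (p i)).prod = (∑ t, f t) ^ m := by
  induction m with
  | zero => simp
  | succ m ih =>
    rw [pow_succ', ← ih, Finset.sum_mul_sum, ← Fintype.sum_prod_type']
    refine (Fintype.sum_equiv (Fin.consEquiv fun _ : Fin (m + 1) => T) _ _ fun p => ?_).symm
    simp [Fin.consEquiv, List.ofFn_succ]

/-- The regular character detects the tuples with product 1. In each irreducible representation the
sum over all tuples is the m-th power of one sum, hence the scalar `c i ^ m`. -/
theorem IrreducibleList.card_mul_card_solutions {G : Type*} [Group G] (L : IrreducibleList G)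
    {T : Type*} [Fintype T] (s : T → G) (c : Fin L.card → ℂ)
    (hc : ∀ i, ∑ t, L.rep i (s t) = c i • LinearMap.id) (m : ℕ) :
    (Nat.card {p : Fin m → T // (List.ofFn fun i => s (p i)).prod = 1} : ℂ) * Nat.card G =
      ∑ i, (L.deg i : ℂ) ^ 2 * c i ^ m := by
  classical
  have h1 (i) : ∑ p : Fin m → T, (L.rep i).character (List.ofFn fun j => s (p j)).prod =
      L.deg i * c i ^ m := by
    simp_rw [Representation.character]
    rw [← map_sum]
    have h2 (p : Fin m → T) : L.rep i (List.ofFn fun j => s (p j)).prod =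
        (List.ofFn fun j => L.rep i (s (p j))).prod := by
      rw [map_list_prod, List.map_ofFn]
      rfl
    simp_rw [h2]
    rw [sum_prod_ofFn (fun t => L.rep i (s t)), hc, ← Module.End.one_eq_id, smul_pow, one_pow, map_smul,
      LinearMap.trace_one, Module.finrank_fin_fun, smul_eq_mul, mul_comm]
  have h3 : ∑ p : Fin m → T, ∑ i, (L.deg i : ℂ) *
      (L.rep i).character (List.ofFn fun j => s (p j)).prod = ∑ i, (L.deg i : ℂ) ^ 2 * c i ^ m := by
    rw [Finset.sum_comm]
    simp_rw [← Finset.mul_sum, h1]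
    exact Finset.sum_congr rfl fun i _ => by ring
  rw [← h3]
  simp_rw [L.sum_deg_mul_character]
  rw [← Finset.sum_filter, Finset.sum_const, nsmul_eq_mul, Nat.card_eq_fintype_card,
    Fintype.card_subtype]

section WordCount

variable {Γ : Type*} [Group Γ] {G : Subgroup Γ}

theorem wordCount_wordV (hG : G.index = 2) (m : ℕ) :
    wordCount G (wordV m) 1 = Nat.card {p : Fin m → {x : Γ // x ∉ G} //
      (List.ofFn fun i => squareIn hG (p i).1).prod = 1} := by
  refine Nat.card_congr (Equiv.subtypeEquiv (Equiv.uniqueProd _ (Fin 0 → G)) fun p => ?_)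
  rw [← OneMemClass.coe_eq_one, SubmonoidClass.coe_list_prod]
  simp [wordV, map_list_prod, List.map_ofFn, Function.comp_def, squareIn, sq]

/-- The tuples of variables that occur in `wordW`, grouped into blocks. -/
def blockEquiv (A B : Type*) (n : ℕ) : (Fin (2 * n) → A) × (Fin n → B) ≃ (Fin n → A × A × B) where
  toFun p i := (p.1 ⟨2 * i, by omega⟩, p.1 ⟨2 * i + 1, by omega⟩, p.2 i)
  invFun q := (fun j => if j.1 % 2 = 0 then (q ⟨j.1 / 2, by omega⟩).1
    else (q ⟨j.1 / 2, by omega⟩).2.1, fun i => (q i).2.2)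
  left_inv p := by
    refine Prod.ext (funext fun j => ?_) rfl
    dsimp only
    split_ifs with h
    · exact congrArg p.1 (Fin.ext (show 2 * (j.1 / 2) = j.1 by omega))
    · exact congrArg p.1 (Fin.ext (show 2 * (j.1 / 2) + 1 = j.1 by omega))
  right_inv q := by
    funext i
    have h1 : (2 * (i : ℕ) + 1) / 2 = i := by omega
    have h2 : (2 * (i : ℕ) + 1) % 2 ≠ 0 := by omega
    simp [h1]

theorem wordCount_wordW (hG : G.index = 2) (n : ℕ) :
    wordCount G (wordW n) 1 = Nat.card {p : Fin n → G × G × {x : Γ // x ∉ G} //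
      (List.ofFn fun i => ((p i).1 * (p i).1) * ((p i).2.1 * (p i).2.1) *
        squareIn hG (p i).2.2.1).prod = 1} := by
  refine Nat.card_congr (Equiv.subtypeEquiv (blockEquiv G _ n) fun p => ?_)
  rw [← OneMemClass.coe_eq_one, SubmonoidClass.coe_list_prod]
  simp [wordW, map_list_prod, List.map_ofFn, Function.comp_def, squareIn, sq, blockEquiv]

variable [Finite Γ] {hG : G.index = 2} (D : RealData hG)

namespace RealData

-- The set of summation is stable under conjugation, so the sum commutes with the representation;
-- Schur's lemma makes it a scalar and the trace identifies it.
omit [Finite Γ] in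
theorem sum_rep_lin [Fintype G] (i : Fin D.card) :
    ∑ g : G, D.rep i (g * g) = ((Nat.card G * D.lin i / D.deg i : ℂ)) • LinearMap.id := by
  obtain ⟨c, hc⟩ := (D.isIrreducible i).exists_eq_smul (∑ g : G, D.rep i (g * g)) fun h v => by
    rw [LinearMap.sum_apply, LinearMap.sum_apply, map_sum]
    refine (Fintype.sum_equiv (MulAut.conj h⁻¹).toEquiv _ _ fun g => ?_)
    simp only [← Module.End.mul_apply, ← map_mul]
    congr 2
    simp [mul_assoc]
  have hd : (D.deg i : ℂ) ≠ 0 := by exact_mod_cast (D.deg_pos i).ne'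
  have hc' : ∑ g : G, D.rep i (g * g) = c • LinearMap.id := LinearMap.ext hc
  have h := congrArg (LinearMap.trace ℂ _) hc'
  rw [map_sum, map_smul, LinearMap.trace_id, Module.finrank_fin_fun, smul_eq_mul] at h
  have h2 := D.sum_lin i
  rw [finsum_eq_sum_of_fintype] at h2
  rw [hc', ← h2]
  congr 1
  exact (eq_div_iff hd).2 h.symm

omit [Finite Γ] in
theorem sum_rep_real [Fintype {x : Γ // x ∉ G}] (i : Fin D.card) :
    ∑ x : {x : Γ // x ∉ G}, D.rep i (squareIn hG x.1) =
      ((Nat.card G * D.real i / D.deg i : ℂ)) • LinearMap.id := by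
  obtain ⟨c, hc⟩ := (D.isIrreducible i).exists_eq_smul
    (∑ x : {x : Γ // x ∉ G}, D.rep i (squareIn hG x.1)) fun h v => by
    rw [LinearMap.sum_apply, LinearMap.sum_apply, map_sum]
    have := Subgroup.normal_of_index_eq_two hG
    refine (Fintype.sum_equiv (Equiv.subtypeEquiv (MulAut.conj (h : Γ)⁻¹).toEquiv fun x => not_congr ?_)
      _ _ fun g => ?_)
    · exact ⟨fun hx => this.conj_mem x hx _, fun hx => by
        simpa [mul_assoc] using this.conj_mem _ hx h⟩
    · simp only [← Module.End.mul_apply, ← map_mul]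
      congr 2
      exact Subtype.ext (by simp [squareIn, mul_assoc])
  have hd : (D.deg i : ℂ) ≠ 0 := by exact_mod_cast (D.deg_pos i).ne'
  have hc' : ∑ x : {x : Γ // x ∉ G}, D.rep i (squareIn hG x.1) = c • LinearMap.id :=
    LinearMap.ext hc
  have h := congrArg (LinearMap.trace ℂ _) hc'
  rw [map_sum, map_smul, LinearMap.trace_id, Module.finrank_fin_fun, smul_eq_mul] at h
  have h2 := D.sum_real i
  rw [finsum_eq_sum_of_fintype] at h2
  rw [hc', ← h2]
  congr 1
  exact (eq_div_iff hd).2 h.symm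

theorem wordCount_wordV_mul (m : ℕ) :
    (wordCount G (wordV m) 1 : ℚ) * Nat.card G =
      ∑ i, (D.deg i : ℚ) ^ 2 * (Nat.card G * D.real i / D.deg i) ^ m := by
  classical
  have := Fintype.ofFinite Γ
  have h := D.card_mul_card_solutions (fun x : {x : Γ // x ∉ G} => squareIn hG x.1) _
    D.sum_rep_real m
  rw [wordCount_wordV hG]
  exact_mod_cast h

/-- A block y²y'²z² contributes the product of the three scalars of its squares. -/
theorem wordCount_wordW_mul (n : ℕ) :
    (wordCount G (wordW n) 1 : ℚ) * Nat.card G =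
      ∑ i, (D.deg i : ℚ) ^ 2 *
        ((Nat.card G / D.deg i) ^ 3 * (D.lin i ^ 2 * D.real i)) ^ n := by
  classical
  have := Fintype.ofFinite Γ
  have h := D.card_mul_card_solutions
    (fun x : G × G × {x : Γ // x ∉ G} => (x.1 * x.1) * (x.2.1 * x.2.1) * squareIn hG x.2.2.1)
    (fun i => (Nat.card G / D.deg i) ^ 3 * (D.lin i ^ 2 * D.real i)) (fun i => by
      simp_rw [map_mul, Fintype.sum_prod_type]
      have h1 : ∀ x y : G, ∑ z : {x : Γ // x ∉ G},
          D.rep i x * D.rep i x * (D.rep i y * D.rep i y) * D.rep i (squareIn hG z.1) =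
          D.rep i (x * x) * (D.rep i (y * y) * ∑ z : {x : Γ // x ∉ G}, D.rep i (squareIn hG z.1)) := by
        intro x y
        rw [Finset.mul_sum, Finset.mul_sum, map_mul, map_mul]
        exact Finset.sum_congr rfl fun _ _ => by rw [mul_assoc (_ * _)]
      simp_rw [h1]
      simp_rw [← Finset.mul_sum, ← Finset.sum_mul, D.sum_rep_lin, D.sum_rep_real]
      rw [← Module.End.one_eq_id, smul_mul_smul_comm, smul_mul_smul_comm, one_mul, one_mul]
      congr 1
      ring) n
  rw [wordCount_wordW hG]
  refine (Rat.cast_inj (α := ℂ)).1 ?_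
  push_cast
  exact h

end RealData

end WordCount

/-! ### Power sums -/

/-- Newton's identities over ℚ express the elementary symmetric functions through the power sums, so
both families are the roots of the same polynomial. -/
theorem multiset_map_eq_of_sum_pow_eq {k : ℕ} {x y : Fin k → ℚ}
    (h : ∀ j, 1 ≤ j → j ≤ k → ∑ i, x i ^ j = ∑ i, y i ^ j) :
    Finset.univ.val.map x = Finset.univ.val.map y := by
  have h1 : ∀ j, j ≤ k → MvPolynomial.aeval x (MvPolynomial.esymm (Fin k) ℚ j) =
      MvPolynomial.aeval y (MvPolynomial.esymm (Fin k) ℚ j) := by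
    intro j
    induction j using Nat.strong_induction_on with
    | _ j ih =>
      intro hj
      rcases Nat.eq_zero_or_pos j with rfl | hj0
      · simp
      have h2 := congrArg (MvPolynomial.aeval x) (MvPolynomial.mul_esymm_eq_sum (Fin k) ℚ j)
      have h3 := congrArg (MvPolynomial.aeval y) (MvPolynomial.mul_esymm_eq_sum (Fin k) ℚ j)
      simp only [map_mul, map_sum, map_pow, map_neg, map_one, map_natCast] at h2 h3
      refine mul_left_cancel₀ (Nat.cast_ne_zero.2 hj0.ne' : (j : ℚ) ≠ 0) ?_
      rw [h2, h3]
      congr 1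
      refine Finset.sum_congr rfl fun a ha => ?_
      rw [Finset.mem_filter, Finset.HasAntidiagonal.mem_antidiagonal] at ha
      rw [ih a.1 ha.2 (by omega)]
      congr 1
      simpa [MvPolynomial.psum] using h a.2 (by omega) (by omega)
  have h2 : ((Finset.univ.val.map x).map (fun t => Polynomial.X - Polynomial.C t)).prod =
      ((Finset.univ.val.map y).map (fun t => Polynomial.X - Polynomial.C t)).prod := by
    rw [Multiset.prod_X_sub_X_eq_sum_esymm, Multiset.prod_X_sub_X_eq_sum_esymm]
    simp only [Multiset.card_map, Finset.card_val, Finset.card_univ, Fintype.card_fin]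
    refine Finset.sum_congr rfl fun j hj => ?_
    rw [← MvPolynomial.aeval_esymm_eq_multiset_esymm (Fin k) ℚ, ← MvPolynomial.aeval_esymm_eq_multiset_esymm (Fin k) ℚ, h1 j (by simpa [Nat.lt_succ_iff] using hj)]
  simpa only [Polynomial.roots_multiset_prod_X_sub_C] using congrArg Polynomial.roots h2

/-- Both families are padded with zeros to length k, which changes neither the power sums nor the
sums of F. -/
theorem sum_eq_of_sum_pow_eq {a b k : ℕ} (ha : a ≤ k) (hb : b ≤ k) {x : Fin a → ℚ} {y : Fin b → ℚ}
    (h : ∀ j, 1 ≤ j → j ≤ k → ∑ i, x i ^ j = ∑ i, y i ^ j) (F : ℚ → ℕ) (hF : F 0 = 0) :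
    ∑ i, F (x i) = ∑ i, F (y i) := by
  have key {c : ℕ} (hc : c ≤ k) (z : Fin c → ℚ) {R : Type} [AddCommMonoid R] (f : ℚ → R)
      (hf : f 0 = 0) : ∑ i : Fin k, f (if hi : i < c then z ⟨i, hi⟩ else 0) = ∑ i, f (z i) := by
    obtain ⟨d, rfl⟩ := Nat.exists_eq_add_of_le hc
    simp [Fin.sum_univ_add, hf]
  have h1 := multiset_map_eq_of_sum_pow_eq (k := k)
    (x := fun i => if hi : i < a then x ⟨i, hi⟩ else 0)
    (y := fun i => if hi : i < b then y ⟨i, hi⟩ else 0) fun j hj hjk => by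
      rw [key ha x (· ^ j) (zero_pow (by omega)), key hb y (· ^ j) (zero_pow (by omega)), h j hj hjk]
  rw [← key ha x F hF, ← key hb y F hF]
  simpa [Finset.sum, Function.comp_def] using congrArg (fun s => (s.map F).sum) h1

/-- On the finitely many points involved F agrees with a polynomial of degree at most K without
constant term, whose weighted sums are combinations of the given moments. -/
theorem sum_mul_eq_of_sum_mul_pow_eq {a b K : ℕ} (hK : a + b ≤ K) {w x : Fin a → ℚ}
    {w' y : Fin b → ℚ}
    (h : ∀ j, 1 ≤ j → j ≤ K → ∑ i, w i * x i ^ j = ∑ i, w' i * y i ^ j) (F : ℚ → ℚ) (hF : F 0 = 0) :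
    ∑ i, w i * F (x i) = ∑ i, w' i * F (y i) := by
  classical
  -- The node 0 makes the constant term vanish, as the moment of exponent 0 is not among the data.
  set S : Finset ℚ := insert 0 (Finset.univ.image x ∪ Finset.univ.image y) with hS
  have hcard : S.card ≤ K + 1 := by
    refine (Finset.card_insert_le _ _).trans (Nat.succ_le_succ ((Finset.card_union_le _ _).trans ?_))
    refine (add_le_add Finset.card_image_le Finset.card_image_le).trans ?_
    simpa using hK
  set P := Lagrange.interpolate S id F with hP
  have hinj : Set.InjOn (id : ℚ → ℚ) S := Function.injective_id.injOn
  have hev : ∀ t ∈ S, P.eval t = F t := fun t ht => Lagrange.eval_interpolate_at_node F hinj ht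
  have hdeg : P.natDegree < K + 1 := by
    have := Lagrange.degree_interpolate_lt F hinj
    rw [Nat.lt_succ_iff]
    refine Polynomial.natDegree_le_of_degree_le (Order.le_of_lt_succ ?_)
    exact this.trans_le (Nat.cast_le.2 hcard)
  have h0 : P.coeff 0 = 0 := by
    rw [Polynomial.coeff_zero_eq_eval_zero, hev 0 (Finset.mem_insert_self _ _), hF]
  have hx (i) : F (x i) = ∑ j ∈ Finset.range (K + 1), P.coeff j * x i ^ j := by
    rw [← hev (x i) (by simp [hS]), Polynomial.eval_eq_sum_range' hdeg]
  have hy (i) : F (y i) = ∑ j ∈ Finset.range (K + 1), P.coeff j * y i ^ j := by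
    rw [← hev (y i) (by simp [hS]), Polynomial.eval_eq_sum_range' hdeg]
  simp_rw [hx, hy, Finset.mul_sum]
  rw [Finset.sum_comm, Finset.sum_comm (t := Finset.range (K + 1))]
  refine Finset.sum_congr rfl fun j hj => ?_
  rcases Nat.eq_zero_or_pos j with rfl | hj0
  · simp [h0]
  · simp_rw [mul_left_comm _ (P.coeff j), ← Finset.mul_sum]
    rw [h j hj0 (by simpa [Nat.lt_succ_iff] using hj)]

/-! ### The numbers of characters of each type -/

namespace RealData

variable {Γ : Type*} [Group Γ] [Finite Γ] {G : Subgroup Γ} {hG : G.index = 2} (D : RealData hG)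

/-- The factor d² lowers the exponent of d from j + 2 to j, and ε^(j+2) = ε^j because ε is 0 or ±1.
The latter fails at ε = 0 when j = 0, which is why the words start at m = 3. -/
theorem wordCount_wordV_mul' {j : ℕ} (hj : 1 ≤ j) :
    (wordCount G (wordV (j + 2)) 1 : ℚ) * Nat.card G =
      (Nat.card G : ℚ) ^ (j + 2) * ∑ i, ((D.real i : ℚ) / D.deg i) ^ j := by
  rw [D.wordCount_wordV_mul, Finset.mul_sum]
  refine Finset.sum_congr rfl fun i _ => ?_
  have hd : (D.deg i : ℚ) ≠ 0 := by exact_mod_cast (D.deg_pos i).ne'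
  have h2 : (D.real i : ℚ) ^ (j + 2) = (D.real i : ℚ) ^ j := by
    rcases D.real_mem i with h | h | h <;> simp [h, pow_add, zero_pow (by omega : j ≠ 0)]
  rw [div_pow, mul_pow, h2, div_pow, pow_add (D.deg i : ℚ) j 2]
  field_simp

omit [Finite Γ] in
theorem card_le_card : D.card ≤ Nat.card G := by
  rw [← D.sum_deg_sq]
  simpa using Finset.sum_le_sum fun i (_ : i ∈ Finset.univ) => Nat.one_le_pow 2 _ (D.deg_pos i)

omit [Finite Γ] in
theorem real_div_pos_iff (i : Fin D.card) : 0 < (D.real i : ℚ) / D.deg i ↔ D.real i = 1 := by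
  have hd := D.deg_pos i
  rcases D.real_mem i with h | h | h <;> simp [h, hd]

omit [Finite Γ] in
theorem real_div_neg_iff (i : Fin D.card) : (D.real i : ℚ) / D.deg i < 0 ↔ D.real i = -1 := by
  have hd := D.deg_pos i
  rcases D.real_mem i with h | h | h <;> simp [h, hd, div_neg_iff]

/-- The scaled sign whose powers control the numbers of solutions for the words `wordW`. -/
noncomputable def scaledSign (i : Fin D.card) : ℚ :=
  (D.lin i ^ 2 * D.real i : ℤ) * (Nat.card G / D.deg i : ℚ)

omit [Finite Γ] in
theorem sign_mem (i : Fin D.card) : D.lin i ^ 2 * D.real i = 0 ∨ D.lin i ^ 2 * D.real i = 1 ∨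
    D.lin i ^ 2 * D.real i = -1 := by
  rcases D.real_mem i with h | h | h <;> rcases D.lin_mem i with h' | h' | h' <;> simp [h, h']

/-- The sign equals its own cube, so the scalar of a block is a perfect cube. -/
theorem wordCount_wordW_eq (n : ℕ) : (wordCount G (wordW n) 1 : ℚ) =
    ∑ i, ((D.deg i : ℚ) ^ 2 / Nat.card G) * (D.scaledSign i ^ 3) ^ n := by
  have hN : (Nat.card G : ℚ) ≠ 0 := by exact_mod_cast Nat.card_pos.ne'
  rw [← mul_left_inj' hN, D.wordCount_wordW_mul, Finset.sum_mul]
  refine Finset.sum_congr rfl fun i _ => ?_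
  have h : ((D.lin i ^ 2 * D.real i : ℤ) : ℚ) ^ 3 = (D.lin i ^ 2 * D.real i : ℤ) := by
    rcases D.sign_mem i with h | h | h <;> norm_num [h]
  rw [scaledSign, mul_pow _ _ 3, h]
  push_cast
  field_simp

theorem exists_scaledSign_eq : ∃ i, D.deg i = 1 ∧ D.scaledSign i = Nat.card G := by
  obtain ⟨i, h1, h2, h3⟩ := D.exists_trivial
  exact ⟨i, h1, by simp [scaledSign, h1, h2, h3]⟩

omit [Finite Γ] in
theorem abs_scaledSign_le (i : Fin D.card) : |D.scaledSign i| ≤ Nat.card G := by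
  have h1 : (Nat.card G / D.deg i : ℚ) ≤ Nat.card G :=
    div_le_self (Nat.cast_nonneg _) (by exact_mod_cast D.deg_pos i)
  have h2 : (0 : ℚ) ≤ Nat.card G / D.deg i := by positivity
  rw [scaledSign, abs_mul, abs_of_nonneg h2]
  rcases D.sign_mem i with h | h | h <;> simp [h, h1]

omit [Finite Γ] in
theorem weight_nonneg (i : Fin D.card) : (0 : ℚ) ≤ (D.deg i : ℚ) ^ 2 / Nat.card G := by positivity

theorem sum_weight : ∑ i, (D.deg i : ℚ) ^ 2 / Nat.card G = 1 := by
  have hN : (Nat.card G : ℚ) ≠ 0 := by exact_mod_cast Nat.card_pos.ne'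
  rw [← Finset.sum_div, div_eq_one_iff_eq hN]
  exact_mod_cast D.sum_deg_sq

/-- The weights have total mass 1 and every atom has absolute value at most |G|. -/
theorem wordCount_wordW_two_le (D : RealData hG) : (wordCount G (wordW 2) 1 : ℚ) ≤ (Nat.card G : ℚ) ^ 6 := by
  rw [D.wordCount_wordW_eq, ← one_mul ((Nat.card G : ℚ) ^ 6), ← D.sum_weight, Finset.sum_mul]
  refine Finset.sum_le_sum fun i _ => mul_le_mul_of_nonneg_left ?_ (D.weight_nonneg i)
  rw [← pow_mul, ← Even.pow_abs (by decide : Even (3 * 2))]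
  exact pow_le_pow_left₀ (abs_nonneg _) (D.abs_scaledSign_le i) _

/-- For n = 2 the exponent is even, so all terms are nonnegative; the trivial character alone
contributes |G|⁶/|G|. -/
theorem le_wordCount_wordW_two (D : RealData hG) : (Nat.card G : ℚ) ^ 5 ≤ wordCount G (wordW 2) 1 := by
  have hN : (Nat.card G : ℚ) ≠ 0 := by exact_mod_cast Nat.card_pos.ne'
  obtain ⟨i, h1, h2⟩ := D.exists_scaledSign_eq
  rw [D.wordCount_wordW_eq]
  refine le_trans (le_of_eq ?_) (Finset.single_le_sum (fun i _ => mul_nonneg (D.weight_nonneg i) ?_)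
    (Finset.mem_univ i))
  · rw [h1, h2]
    field_simp
    simp
  · rw [← pow_mul]
    exact Even.pow_nonneg (by decide) _

theorem scaledSign_pos_iff (i : Fin D.card) :
    0 < D.scaledSign i ↔ D.lin i ^ 2 * D.real i = 1 := by
  have h1 : (0 : ℚ) < Nat.card G / D.deg i :=
    div_pos (by exact_mod_cast Nat.card_pos) (by exact_mod_cast D.deg_pos i)
  rw [scaledSign, mul_pos_iff_of_pos_right h1]
  rcases D.sign_mem i with h | h | h <;> simp [h]

theorem scaledSign_neg_iff (i : Fin D.card) :
    D.scaledSign i < 0 ↔ D.lin i ^ 2 * D.real i = -1 := by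
  have h1 : (0 : ℚ) < Nat.card G / D.deg i :=
    div_pos (by exact_mod_cast Nat.card_pos) (by exact_mod_cast D.deg_pos i)
  rw [scaledSign, ← neg_pos, ← neg_mul, mul_pos_iff_of_pos_right h1]
  rcases D.sign_mem i with h | h | h <;> simp [h]

/-- When t = ±|G|/d, the weight d²/|G| is the inverse of t²/|G|. A test function of t can thus
cancel the weights and count characters. -/
theorem weight_mul_scaledSign_sq {i : Fin D.card}
    (h : D.lin i ^ 2 * D.real i = 1 ∨ D.lin i ^ 2 * D.real i = -1) :
    ((D.deg i : ℚ) ^ 2 / Nat.card G) * (D.scaledSign i ^ 2 / Nat.card G) = 1 := by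
  have hN : (Nat.card G : ℚ) ≠ 0 := by exact_mod_cast Nat.card_pos.ne'
  have hd : (D.deg i : ℚ) ≠ 0 := by exact_mod_cast (D.deg_pos i).ne'
  have h2 : ((D.lin i ^ 2 * D.real i : ℤ) : ℚ) ^ 2 = 1 := by
    rcases h with h | h <;> norm_num [h]
  rw [scaledSign, mul_pow, h2]
  field_simp

theorem sum_weight_mul_pos : ∑ i, ((D.deg i : ℚ) ^ 2 / Nat.card G) *
      (if 0 < D.scaledSign i then D.scaledSign i ^ 2 / Nat.card G else 0) =
    (∑ i, if D.lin i ^ 2 * D.real i = 1 then 1 else 0 : ℕ) := by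
  rw [Nat.cast_sum]
  refine Finset.sum_congr rfl fun i _ => ?_
  simp only [scaledSign_pos_iff]
  split_ifs with h
  · rw [D.weight_mul_scaledSign_sq (Or.inl h), Nat.cast_one]
  · simp

theorem sum_weight_mul_neg : ∑ i, ((D.deg i : ℚ) ^ 2 / Nat.card G) *
      (if D.scaledSign i < 0 then D.scaledSign i ^ 2 / Nat.card G else 0) =
    (∑ i, if D.lin i ^ 2 * D.real i = -1 then 1 else 0 : ℕ) := by
  rw [Nat.cast_sum]
  refine Finset.sum_congr rfl fun i _ => ?_
  simp only [scaledSign_neg_iff]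
  split_ifs with h
  · rw [D.weight_mul_scaledSign_sq (Or.inr h), Nat.cast_one]
  · simp

end RealData

/-! ### Comparing two groups with Real structures. -/

section Comparison

variable {Γ : Type*} {Δ : Type*} [Group Γ] [Finite Γ] [Group Δ] [Finite Δ]
  {G : Subgroup Γ} {H : Subgroup Δ} {hG : G.index = 2} {hH : H.index = 2}

theorem numDyson_eq_of_wordCount_wordV_eq (D : RealData hG) (E : RealData hH)
    (hcard : Nat.card H = Nat.card G)
    (hcl : Nat.card (ConjClasses H) ≤ Nat.card (ConjClasses G))
    (h : ∀ m : ℕ, 3 ≤ m → m < 3 + (1 + Nat.card (ConjClasses G)) →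
      wordCount H (wordV m) 1 = wordCount G (wordV m) 1) :
    numDyson H .I + numDyson H .V + numDyson H .IX =
        numDyson G .I + numDyson G .V + numDyson G .IX ∧
      numDyson H .II + numDyson H .VI + numDyson H .VIII =
        numDyson G .II + numDyson G .VI + numDyson G .VIII := by
  classical
  have key := sum_eq_of_sum_pow_eq (E.card_le.trans hcl) D.card_le
    (x := fun i => (E.real i : ℚ) / E.deg i) (y := fun i => (D.real i : ℚ) / D.deg i)
    fun j hj hjk => by
      have hN : (Nat.card G : ℚ) ≠ 0 := by exact_mod_cast Nat.card_pos.ne'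
      have h1 := E.wordCount_wordV_mul' hj
      rw [h (j + 2) (by omega) (by omega), hcard, D.wordCount_wordV_mul' hj] at h1
      exact (mul_left_cancel₀ (pow_ne_zero _ hN) h1).symm
  rw [D.numDyson_real_eq, E.numDyson_real_eq, D.numDyson_quaternion_eq, E.numDyson_quaternion_eq]
  constructor
  · simpa only [RealData.real_div_pos_iff] using key (fun t => if 0 < t then 1 else 0) (by simp)
  · simpa only [RealData.real_div_neg_iff] using key (fun t => if t < 0 then 1 else 0) (by simp)

-- The trivial character gives the measure of H positive mass at |H|, while all atoms for G are at
-- most |G|. The indicator function of the point |H| would separate the two measures if |H| were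
-- larger.
omit [Finite Γ] in
theorem card_le_of_sum_weight_eq (D : RealData hG) (E : RealData hH)
    (h : ∀ F : ℚ → ℚ, F 0 = 0 → ∑ i, ((E.deg i : ℚ) ^ 2 / Nat.card H) * F (E.scaledSign i) =
      ∑ i, ((D.deg i : ℚ) ^ 2 / Nat.card G) * F (D.scaledSign i)) :
    Nat.card H ≤ Nat.card G := by
  classical
  by_contra! hlt
  have hH0 : (0 : ℚ) < Nat.card H := by exact_mod_cast Nat.card_pos
  have h1 := h (fun t => if t = Nat.card H then 1 else 0) (if_neg hH0.ne)
  rw [Finset.sum_eq_zero (s := (Finset.univ : Finset (Fin D.card)))] at h1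
  · obtain ⟨i, hi, hs⟩ := E.exists_scaledSign_eq
    have h2 := (Finset.sum_eq_zero_iff_of_nonneg fun i _ =>
      mul_nonneg (E.weight_nonneg i) (by split_ifs <;> norm_num)).1 h1 i (Finset.mem_univ i)
    rw [hi, if_pos hs, mul_one, Nat.cast_one, one_pow, div_eq_zero_iff] at h2
    exact h2.elim one_ne_zero hH0.ne'
  · intro i _
    have h2 : D.scaledSign i ≤ Nat.card G := (le_abs_self _).trans (D.abs_scaledSign_le i)
    have h3 : (Nat.card G : ℚ) < Nat.card H := by exact_mod_cast hlt
    rw [if_neg (h2.trans_lt h3).ne, mul_zero]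

/-- The two bounds on the common value give |H|⁵ ≤ |G|⁶. This bounds |H|, and so the number of atoms
for H, before the moments are compared. -/
theorem card_le_sq_of_wordCount_wordW_eq (D : RealData hG) (E : RealData hH)
    (h : wordCount H (wordW 2) 1 = wordCount G (wordW 2) 1) :
    Nat.card H ≤ Nat.card G ^ 2 := by
  by_contra! hlt
  have h1 : Nat.card H ^ 5 ≤ Nat.card G ^ 6 := by
    have := E.le_wordCount_wordW_two.trans ((congrArg Nat.cast h).trans_le D.wordCount_wordW_two_le)
    exact_mod_cast this
  have h2 : (Nat.card G ^ 2) ^ 5 < Nat.card H ^ 5 := Nat.pow_lt_pow_left hlt (by norm_num)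
  rw [← pow_mul] at h2
  exact absurd (h2.trans_le h1) (Nat.pow_le_pow_right Nat.card_pos (by norm_num)).not_gt

theorem numDyson_eq_of_wordCount_wordW_eq (D : RealData hG) (E : RealData hH)
    (h : ∀ n : ℕ, 1 ≤ n → n ≤ Nat.card G ^ 2 + Nat.card G + 2 →
      wordCount H (wordW n) 1 = wordCount G (wordW n) 1) :
    numDyson H .I + numDyson H .IX = numDyson G .I + numDyson G .IX ∧
      numDyson H .II + numDyson H .VIII = numDyson G .II + numDyson G .VIII := by
  classical
  have hcard := card_le_sq_of_wordCount_wordW_eq D E (h 2 (by omega) (by omega))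
  have hinj : Function.Injective fun t : ℚ => t ^ 3 := (Odd.strictMono_pow (by decide)).injective
  have key : ∀ F : ℚ → ℚ, F 0 = 0 →
      ∑ i, ((E.deg i : ℚ) ^ 2 / Nat.card H) * F (E.scaledSign i) =
        ∑ i, ((D.deg i : ℚ) ^ 2 / Nat.card G) * F (D.scaledSign i) := by
    intro F hF
    -- The moments are those of t³; as cubing is injective on ℚ, any function of t is a function of
    -- t³.
    have hext (t : ℚ) : Function.extend (fun t : ℚ => t ^ 3) F 0 (t ^ 3) = F t :=
      hinj.extend_apply F 0 t
    have h1 := sum_mul_eq_of_sum_mul_pow_eq (a := E.card) (b := D.card)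
      (K := Nat.card G ^ 2 + Nat.card G + 2) (by have := D.card_le_card; have := E.card_le_card; omega)
      (fun n hn hnK => by
        rw [← E.wordCount_wordW_eq, ← D.wordCount_wordW_eq, h n hn hnK])
      (Function.extend (fun t : ℚ => t ^ 3) F 0) (by simpa [hF] using hext 0)
    simpa only [hext] using h1
  have heq : Nat.card H = Nat.card G := (card_le_of_sum_weight_eq D E key).antisymm
    (card_le_of_sum_weight_eq E D fun F hF => (key F hF).symm)
  rw [D.numDyson_real_eq', E.numDyson_real_eq', D.numDyson_quaternion_eq',
    E.numDyson_quaternion_eq']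
  constructor <;> refine Nat.cast_injective (R := ℚ) ?_
  · rw [← D.sum_weight_mul_pos, ← E.sum_weight_mul_pos]
    simpa only [heq] using key (fun t => if 0 < t then t ^ 2 / Nat.card G else 0) (by simp)
  · rw [← D.sum_weight_mul_neg, ← E.sum_weight_mul_neg]
    simpa only [heq] using key (fun t => if t < 0 then t ^ 2 / Nat.card G else 0) (by simp)

end Comparison

theorem mainTheorem3 :
    -- the first `1 + |Cl(G)|` values for the words `v₃, v₄, …`, given the order of the group
    (∀ (Γ : Type u) (Δ : Type v) [Group Γ] [Finite Γ] [Group Δ] [Finite Δ]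
        (G : Subgroup Γ) (H : Subgroup Δ), G.index = 2 → H.index = 2 →
        Nat.card H = Nat.card G →
        Nat.card (ConjClasses H) ≤ Nat.card (ConjClasses G) →
        (∀ m : ℕ, 3 ≤ m → m < 3 + (1 + Nat.card (ConjClasses G)) →
          wordCount H (wordV m) 1 = wordCount G (wordV m) 1) →
        numDyson H .I + numDyson H .V + numDyson H .IX =
            numDyson G .I + numDyson G .V + numDyson G .IX ∧
          numDyson H .II + numDyson H .VI + numDyson H .VIII =
            numDyson G .II + numDyson G .VI + numDyson G .VIII) ∧
    -- finitely many values for the words `w₁, w₂, …`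
    (∀ N : ℕ, ∃ K : ℕ, ∀ (Γ : Type u) (Δ : Type v) [Group Γ] [Finite Γ] [Group Δ] [Finite Δ]
        (G : Subgroup Γ) (H : Subgroup Δ), G.index = 2 → H.index = 2 →
        Nat.card G = N →
        (∀ n : ℕ, 1 ≤ n → n ≤ K → wordCount H (wordW n) 1 = wordCount G (wordW n) 1) →
        numDyson H .I + numDyson H .IX = numDyson G .I + numDyson G .IX ∧
          numDyson H .II + numDyson H .VIII = numDyson G .II + numDyson G .VIII) := by
  -- There are at most |H| ≤ N² atoms for H and at most N for G, so N² + N moments suffice; the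
  -- added 2 puts n = 2, used for the bound on |H|, visibly in the range.
  refine ⟨fun Γ Δ _ _ _ _ G H hG hH hcard hcl h => ?_, fun N => ⟨N ^ 2 + N + 2,
    fun Γ Δ _ _ _ _ G H hG hH hN h => ?_⟩⟩
  · obtain ⟨D⟩ := nonempty_realData hG
    obtain ⟨E⟩ := nonempty_realData hH
    exact numDyson_eq_of_wordCount_wordV_eq D E hcard hcl h
  · subst hN
    obtain ⟨D⟩ := nonempty_realData hG
    obtain ⟨E⟩ := nonempty_realData hH
    exact numDyson_eq_of_wordCount_wordW_eq D E h
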